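/- Let $\xi=\zeta_9$ be a primitive ninth root of unity, $E=\mathbb{Q}(\xi)$ with complex conjugation $x\mapsto\bar x$, $\pi=1-\xi$ (a prime of $\mathcal{O}_E=\mathbb{Z}[\xi]$ above $3$), and let $E_\pi$ be the $\pi$-adic completion of $E$, with ring of integers $\mathcal{O}_{E_\pi}$ and the continuous extension of the conjugation. Let $G_\Pi=\{g\in GL_3(E_\pi) : g^*g=I\}$. Let $\mathcal{B}$ be the Bruhat–Tits building of $GL_3(E_\pi)$: its vertices are the cosets in $GL_3(E_\pi)/\widetilde K$, where $\widetilde K=E_\pi^\times GL_3(\mathcal{O}_{E_\pi})$, and three vertices form a triangle if, in some order, they have representatives $g_1,g_2,g_3$ with $\pi g_3\mathcal{O}_{E_\pi}^3<g_1\mathcal{O}_{E_\pi}^3<g_2\mathcal{O}_{E_\pi}^3<g_3\mathcal{O}_{E_\pi}^3$. The map $g\widetilde K\mapsto (g^*)^{-1}\widetilde K$ induces a simplicial involution $\#$ of $\mathcal{B}$. Let $\mathcal{T}$ be its fixed section, the Bruhat–Tits tree of $G_\Pi$: its vertices are the vertices of $\mathcal{B}$ fixed by $\#$ and the midpoints of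 the edges of $\mathcal{B}$ reflected by $\#$, and a fixed vertex is adjacent to the midpoint of a reflected edge exactly when that vertex and that edge span a triangle of $\mathcal{B}$. Let $\mathrm{dist}$ be the graph distance of $\mathcal{T}$, let $S_n(v)$ be the sphere of radius $n$ around $v$, and let $v_0$ be the vertex $\widetilde K$. Let $\Gamma$ be the group of all unitary $3\times3$ matrices with entries in $\mathbb{Z}[\zeta_9,\tfrac13]$, which acts on $\mathcal{T}$ through $\Gamma\subset G_\Pi$. With $\zeta_3=\xi^3$, let $$H=\frac1{\sqrt{-3}}\begin{pmatrix}1&1&1\\1&\zeta_3&\overline{\zeta_3}\\1&\overline{\zeta_3}&\zeta_3\end{pmatrix},\qquad \mathcal{D}=\left\{\mathrm{diag}(\pm\zeta_9^{a},\pm\zeta_9^{b},\pm\zeta_9^{c}) : a,b,c\in\mathbb{Z}/9\mathbb{Z}\right\}$$ (the signs being independent), and let $\Lambda=\langle H,\mathcal{D}\rangle\leq\Gamma$. For a vertex $v$ of $\mathcal{B}$ fixed by $\#$, two vertices $u,w\in S_6(v)$ belong to the same $v$-clan if they have a common grandfather in $S_4(v)$, that is, there is $p\in S_4(v)$ with $\mathrm{dist}(p,u)=\mathrm{dist}(p,w)=2$.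 Thus the $v$-clans are the sets $\{u\in S_6(v) : \mathrm{dist}(p,u)=2\}$ for $p\in S_4(v)$. **Theorem.** 1. For every $v\in\Gamma v_0$ there are exactly $108$ $v$-clans, and each of them contains exactly one element of the orbit $\Gamma v$. 2. For every $v\in\Gamma v_0$, each $v$-clan contains exactly one element of the orbit $\Lambda v$. 3. $\Lambda v_0=\Gamma v_0$. -/

import Mathlib

open scoped NumberField Matrix

noncomputable section

namespace CliffordD

/-! ## The cyclotomic field `E = ℚ(ζ₉)` with its complex conjugation -/

/-- The ninth cyclotomic field `E = ℚ(ζ₉)`. -/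
abbrev E : Type := CyclotomicField 9 ℚ

/-- `E` is cyclotomic for the standard `ℚ`-algebra structure of a field of characteristic zero. -/
instance : IsCyclotomicExtension {9} ℚ E := by
  have h : @IsCyclotomicExtension {9} ℚ E _ _ (CyclotomicField.algebra 9 ℚ) := inferInstance
  rwa [Subsingleton.elim (CyclotomicField.algebra 9 ℚ)
    (DivisionRing.toRatAlgebra : Algebra ℚ E)] at h

/-- `E` is a CM field; this activates the Mathlib instance `StarRing E`, whose `star` is the
complex conjugation of `E`. -/
instance : NumberField.IsCMField E :=
  IsCyclotomicExtension.Rat.isCMField E (S := {9}) ⟨9, rfl, by norm_num⟩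

/-- A primitive ninth root of unity `ξ = ζ₉`. -/
def xi : E := IsCyclotomicExtension.zeta 9 ℚ E

theorem xi_spec : IsPrimitiveRoot xi 9 := IsCyclotomicExtension.zeta_spec 9 ℚ E

theorem xi_pow_nine : xi ^ 9 = 1 := xi_spec.pow_eq_one

theorem star_xi : star xi = xi ^ 8 := by
  have h : star xi = xi⁻¹ := by
    let φ : E →+* ℂ := Classical.arbitrary _
    apply φ.injective
    have h1 : φ (star xi) = starRingEnd ℂ (φ xi) :=
      NumberField.IsCMField.complexEmbedding_complexConj E φ xi
    have h2 : ‖φ xi‖ = 1 :=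
      Complex.norm_eq_one_of_pow_eq_one (n := 9) (by rw [← map_pow, xi_pow_nine, map_one])
        (by norm_num)
    rw [h1, map_inv₀, Complex.inv_def, Complex.normSq_eq_norm_sq, h2]
    simp
  rw [h]
  refine inv_eq_of_mul_eq_one_right ?_
  rw [← pow_succ', xi_pow_nine]

theorem xi_sum : xi ^ 6 + xi ^ 3 + 1 = 0 := by
  have h3 : IsPrimitiveRoot (xi ^ 3) 3 := xi_spec.pow (by norm_num) (by norm_num)
  have := h3.geom_sum_eq_zero (by norm_num)
  simp only [Finset.sum_range_succ, Finset.sum_range_zero] at this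
  linear_combination this

/-! ## The prime `π = 1 - ξ` and the completion `E_π` -/

/-- The ring element `π = 1 - ξ` of `𝓞 E = ℤ[ξ]`. -/
def piInt : 𝓞 E := 1 - xi_spec.toInteger

theorem prime_piInt : Prime piInt := by
  have h : IsPrimitiveRoot xi (3 ^ (1 + 1)) := by simpa using xi_spec
  have : IsCyclotomicExtension {3 ^ (1 + 1)} ℚ E := by
    norm_num; infer_instance
  have : Fact (Nat.Prime 3) := ⟨Nat.prime_three⟩
  have hp : Prime (h.toInteger - 1) := h.zeta_sub_one_prime
  have : piInt = -(h.toInteger - 1) := by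
    simp only [piInt, neg_sub]
  rw [this]
  exact hp.neg

/-- The prime ideal `(π)` of `𝓞 E`, as a finite place of `E`. -/
def piPlace : IsDedekindDomain.HeightOneSpectrum (𝓞 E) where
  asIdeal := Ideal.span {piInt}
  isPrime := (Ideal.span_singleton_prime prime_piInt.ne_zero).2 prime_piInt
  ne_bot := by simpa using prime_piInt.ne_zero

/-- The `π`-adic completion `E_π` of `E`. -/
abbrev Epi : Type := piPlace.adicCompletion E

/-- The ring of integers of `E_π`. -/
abbrev Opi : ValuationSubring Epi := piPlace.adicCompletionIntegers E

/-- Complex conjugation on `𝓞 E`. -/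
def conjInt : 𝓞 E →+* 𝓞 E :=
  (NumberField.IsCMField.ringOfIntegersComplexConj E : 𝓞 E ≃+* 𝓞 E)

theorem coe_conjInt (r : 𝓞 E) : ((conjInt r : 𝓞 E) : E) = star (r : E) := rfl

theorem conjInt_piInt_mem : conjInt piInt ∈ piPlace.asIdeal := by
  refine Ideal.mem_span_singleton.2 ⟨-xi_spec.toInteger ^ 8, ?_⟩
  apply NumberField.RingOfIntegers.ext
  rw [coe_conjInt]
  have h : ((xi_spec.toInteger : 𝓞 E) : E) = xi := rfl
  simp only [piInt, map_sub, map_one, map_mul, map_neg, map_pow, h, star_sub, star_one, star_xi]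
  linear_combination -xi_pow_nine

theorem intValuation_conjInt_le (r : 𝓞 E) :
    piPlace.intValuation (conjInt r) ≤ piPlace.intValuation r := by
  by_cases hr : r = 0
  · simp [hr]
  rw [piPlace.intValuation_eq_exp_neg_multiplicity hr]
  rw [piPlace.intValuation_le_pow_iff_mem]
  have h1 : r ∈ piPlace.asIdeal ^ multiplicity piPlace.asIdeal (Ideal.span {r}) := by
    rw [← Ideal.dvd_span_singleton]
    exact pow_multiplicity_dvd _ _
  have h2 : Ideal.map conjInt piPlace.asIdeal ≤ piPlace.asIdeal := by
    change Ideal.map conjInt (Ideal.span {piInt}) ≤ _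
    rw [Ideal.map_span, Ideal.span_le]
    simpa using conjInt_piInt_mem
  have h3 := Ideal.mem_map_of_mem conjInt h1
  rw [Ideal.map_pow] at h3
  exact Ideal.pow_right_mono h2 _ h3

theorem valuation_star_le (x : E) : piPlace.valuation E (star x) ≤ piPlace.valuation E x := by
  have hint : ∀ r : 𝓞 E, piPlace.intValuation (conjInt r) = piPlace.intValuation r := by
    intro r
    refine le_antisymm (intValuation_conjInt_le r) ?_
    have h := intValuation_conjInt_le (conjInt r)
    have hh : conjInt (conjInt r) = r := by
      apply NumberField.RingOfIntegers.ext
      rw [coe_conjInt, coe_conjInt, star_star]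
    rwa [hh] at h
  obtain ⟨a, b, hb, rfl⟩ := IsFractionRing.div_surjective (A := 𝓞 E) x
  rw [show star (algebraMap (𝓞 E) E a / algebraMap (𝓞 E) E b)
    = algebraMap (𝓞 E) E (conjInt a) / algebraMap (𝓞 E) E (conjInt b) from map_div₀ (starRingEnd E) _ _]
  simp only [map_div₀, piPlace.valuation_of_algebraMap, hint]
  exact le_rfl

/-- Complex conjugation on `E` with the `π`-adic topology. -/
def conjWithVal : WithVal (piPlace.valuation E) →+* WithVal (piPlace.valuation E) :=
  WithVal.map _ _ (starRingEnd E)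

theorem continuous_conjWithVal : Continuous conjWithVal := by
  refine (uniformContinuous_of_continuousAt_zero conjWithVal ?_).continuous
  simp_rw [ContinuousAt, map_zero, (Valued.hasBasis_nhds_zero _ _).tendsto_iff
    (Valued.hasBasis_nhds_zero _ _), true_and, forall_const]
  intro γ
  refine ⟨γ, fun x hx => ?_⟩
  simp only [Set.mem_ofPred_eq, Valuation.restrict_lt_iff_lt_embedding] at hx ⊢
  exact lt_of_le_of_lt (valuation_star_le x.ofVal) hx

/-- The continuous extension of complex conjugation from `E` to `E_π`. -/
def conjPi : Epi →+* Epi :=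
  ((IsDedekindDomain.HeightOneSpectrum.adicCompletion.equiv E piPlace).symm : _ →+* Epi).comp
    ((UniformSpace.Completion.mapRingHom conjWithVal continuous_conjWithVal).comp
      (IsDedekindDomain.HeightOneSpectrum.adicCompletion.equiv E piPlace : Epi →+* _))

theorem continuous_conjPi : Continuous conjPi :=
  (IsDedekindDomain.HeightOneSpectrum.adicCompletion.continuous_ofCompletion E piPlace).comp
    (UniformSpace.Completion.continuous_map.comp
      (IsDedekindDomain.HeightOneSpectrum.adicCompletion.continuous_toCompletion E piPlace))

theorem conjPi_algebraMap (x : E) : conjPi (algebraMap E Epi x) = algebraMap E Epi (star x) := by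
  apply IsDedekindDomain.HeightOneSpectrum.adicCompletion.ext
  exact UniformSpace.Completion.mapRingHom_coe continuous_conjWithVal
    (WithVal.toVal (piPlace.valuation E) x)

theorem conjPi_conjPi (x : Epi) : conjPi (conjPi x) = x := by
  refine (IsDedekindDomain.HeightOneSpectrum.denseRange_algebraMap (K := E) (v := piPlace)
    ).induction_on (p := fun x => conjPi (conjPi x) = x) x ?_ ?_
  · exact isClosed_eq (continuous_conjPi.comp continuous_conjPi) continuous_id
  · intro a
    rw [conjPi_algebraMap, conjPi_algebraMap, star_star]

/-- The conjugation of `E_π`, written `star`. -/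
instance : StarRing Epi where
  star := conjPi
  star_involutive := conjPi_conjPi
  star_mul x y := by rw [map_mul, mul_comm]
  star_add := map_add conjPi

theorem star_algebraMap (x : E) : star (algebraMap E Epi x) = algebraMap E Epi (star x) :=
  conjPi_algebraMap x

theorem star_mem_Opi {x : Epi} (hx : x ∈ Opi) : star x ∈ Opi := by
  have hopen : IsOpen (Opi : Set Epi) := Valued.isOpen_valuationSubring Epi
  have hclosed : IsClosed (Opi : Set Epi) := Valued.isClosed_valuationSubring Epi
  have key : ∀ y : Epi, y ∈ (Opi : Set Epi)ᶜ ∪ conjPi ⁻¹' (Opi : Set Epi) := by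
    intro y
    refine (IsDedekindDomain.HeightOneSpectrum.denseRange_algebraMap (K := E) (v := piPlace)
      ).induction_on (p := fun y => y ∈ (Opi : Set Epi)ᶜ ∪ conjPi ⁻¹' (Opi : Set Epi)) y ?_ ?_
    · exact hopen.isClosed_compl.union (hclosed.preimage continuous_conjPi)
    · intro a
      by_cases ha : algebraMap E Epi a ∈ Opi
      · right
        change conjPi (algebraMap E Epi a) ∈ Opi
        rw [conjPi_algebraMap]
        rw [IsDedekindDomain.HeightOneSpectrum.mem_adicCompletionIntegers] at ha ⊢
        have h1 := IsDedekindDomain.HeightOneSpectrum.valuedAdicCompletion_eq_valuation' piPlace a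
        have h2 := IsDedekindDomain.HeightOneSpectrum.valuedAdicCompletion_eq_valuation' piPlace
          (star a)
        exact (h2.trans_le (valuation_star_le a)).trans (h1.symm.trans_le ha)
      · exact Or.inl ha
  rcases key x with h | h
  · exact absurd hx h
  · exact h

/-- The restriction of the conjugation of `E_π` to `O_{E_π}`. -/
def conjOpi : Opi →+* Opi :=
  (conjPi.comp Opi.subtype).codRestrict Opi fun x => star_mem_Opi x.2

/-! ## The building `ℬ` of `GL₃(E_π)` -/

/-- The group `GL₃(E_π)`. -/
abbrev GLpi : Type := GL (Fin 3) Epi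

/-- `π = 1 - ξ` as a unit of `E_π`. -/
def piUnit : Epiˣ :=
  Units.mk0 (algebraMap E Epi (1 - xi)) (by
    rw [map_ne_zero_iff _ (algebraMap E Epi).injective, sub_ne_zero]
    exact (xi_spec.ne_one (by norm_num)).symm)

theorem scalar_comm (c : Epiˣ) (g : GLpi) :
    Matrix.GeneralLinearGroup.scalar (Fin 3) c * g =
      g * Matrix.GeneralLinearGroup.scalar (Fin 3) c := by
  ext1
  exact Matrix.scalar_commute (c : Epi) (fun r => mul_comm _ r) g.val

/-- The subgroup `K̃ = E_π^× GL₃(O_{E_π})` of `GL₃(E_π)`. -/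
def Ktilde : Subgroup GLpi where
  carrier := {g | ∃ (c : Epiˣ) (k : GL (Fin 3) Opi),
    g = Matrix.GeneralLinearGroup.scalar (Fin 3) c *
      Matrix.GeneralLinearGroup.map Opi.subtype k}
  one_mem' := ⟨1, 1, by simp⟩
  mul_mem' := by
    rintro _ _ ⟨c, k, rfl⟩ ⟨d, l, rfl⟩
    refine ⟨c * d, k * l, ?_⟩
    rw [map_mul, map_mul, mul_assoc, mul_assoc,
      ← mul_assoc (Matrix.GeneralLinearGroup.map Opi.subtype k),
      ← scalar_comm d (Matrix.GeneralLinearGroup.map Opi.subtype k), mul_assoc]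
  inv_mem' := by
    rintro _ ⟨c, k, rfl⟩
    refine ⟨c⁻¹, k⁻¹, ?_⟩
    rw [mul_inv_rev, map_inv _ k, scalar_comm, map_inv]

/-- The vertices of `ℬ`: the cosets `g K̃`. -/
abbrev BVertex : Type := GLpi ⧸ Ktilde

/-- The `O_{E_π}`-lattice `g O_{E_π}³` in `E_π³`. -/
def lattice (g : GLpi) : Submodule Opi (Fin 3 → Epi) :=
  (LinearMap.range ((Algebra.linearMap Opi Epi).compLeft (Fin 3))).map
    (g.val.mulVecLin.restrictScalars Opi)

/-- The three vertices have representatives `g₁, g₂, g₃` (in this order) with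
`π g₃ O³ < g₁ O³ < g₂ O³ < g₃ O³`. -/
def IsChain (x y z : BVertex) : Prop :=
  ∃ g₁ g₂ g₃ : GLpi, (g₁ : BVertex) = x ∧ (g₂ : BVertex) = y ∧ (g₃ : BVertex) = z ∧
    lattice (Matrix.GeneralLinearGroup.scalar (Fin 3) piUnit * g₃) < lattice g₁ ∧
    lattice g₁ < lattice g₂ ∧ lattice g₂ < lattice g₃

/-- `x, y, z` are the vertices of a triangle of `ℬ`: they form a lattice chain, possibly after a
permutation. -/
def IsTriangle (x y z : BVertex) : Prop :=
  ∃ σ : Equiv.Perm (Fin 3),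
    IsChain (![x, y, z] (σ 0)) (![x, y, z] (σ 1)) (![x, y, z] (σ 2))

/-- `x` and `y` are the endpoints of an edge of `ℬ`, that is, of a side of a triangle. -/
def IsEdge (x y : BVertex) : Prop := ∃ z, IsTriangle x y z

/-! ## The involution `#` -/

/-- The involution `g ↦ g^# = (g^*)⁻¹` of `GL₃(E_π)`, for the standard Hermitian form. -/
def sharp : GLpi →* GLpi where
  toFun g := (star g)⁻¹
  map_one' := by simp
  map_mul' g h := by rw [star_mul, mul_inv_rev]

/-- The conjugate transpose of an element of `GL₃(O_{E_π})`. -/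
def starOpi (k : GL (Fin 3) Opi) : GL (Fin 3) Opi where
  val := (k.val.map conjOpi)ᵀ
  inv := (k⁻¹.val.map conjOpi)ᵀ
  val_inv := by
    rw [← Matrix.transpose_mul, ← Matrix.map_mul, ← Units.val_mul, inv_mul_cancel]
    simp
  inv_val := by
    rw [← Matrix.transpose_mul, ← Matrix.map_mul, ← Units.val_mul, mul_inv_cancel]
    simp

theorem sharp_mem_Ktilde {g : GLpi} (hg : g ∈ Ktilde) : sharp g ∈ Ktilde := by
  obtain ⟨c, k, rfl⟩ := hg
  rw [map_mul]
  refine mul_mem ⟨(star c)⁻¹, 1, ?_⟩ ⟨1, (starOpi k)⁻¹, ?_⟩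
  · rw [map_one, mul_one, map_inv]
    change (star (Matrix.GeneralLinearGroup.scalar (Fin 3) c))⁻¹ = _
    congr 1
    ext1
    change star (Matrix.scalar (Fin 3) (c : Epi)) = Matrix.scalar (Fin 3) (star (c : Epi))
    rw [Matrix.scalar_apply, Matrix.scalar_apply, Matrix.star_eq_conjTranspose,
      Matrix.diagonal_conjTranspose]
    rfl
  · rw [map_one, one_mul, map_inv]
    change (star (Matrix.GeneralLinearGroup.map Opi.subtype k))⁻¹ = _
    congr 1

/-- The induced involution `(g K̃)^# = g^# K̃` on the vertices of `ℬ`. -/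
def sharpB : BVertex → BVertex :=
  Quotient.map' sharp (by
    intro a b h
    rw [QuotientGroup.leftRel_apply] at h ⊢
    rw [← map_inv, ← map_mul]
    exact sharp_mem_Ktilde h)

@[simp]
theorem sharpB_mk (g : GLpi) : sharpB (g : BVertex) = ((sharp g : GLpi) : BVertex) := rfl

/-! ## The tree `𝒯` -/

/-- The vertices of `ℬ` fixed by `#`. -/
abbrev LVertex : Type := {x : BVertex // sharpB x = x}

/-- The edges of `ℬ` reflected by `#`; they stand for their midpoints. -/
abbrev RVertex : Type :=
  {e : Sym2 BVertex // ∃ x y, e = s(x, y) ∧ IsEdge x y ∧ sharpB x = y ∧ sharpB y = x}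

/-- The vertices of the tree `𝒯`. -/
abbrev Vertex : Type := LVertex ⊕ RVertex

/-- The `#`-fixed vertex `x` and the `#`-reflected edge `e` form a triangle of `ℬ`. The points of
this triangle fixed by `#` are then the segment from `x` to the midpoint of `e`. -/
def Incident (x : LVertex) (e : RVertex) : Prop :=
  ∃ y z, e.1 = s(y, z) ∧ IsTriangle x.1 y z

/-- The tree `𝒯`, the fixed section of `#` on `ℬ`. -/
def tree : SimpleGraph Vertex where
  Adj
    | .inl x, .inr e => Incident x e
    | .inr e, .inl x => Incident x e
    | _, _ => False
  symm := ⟨by rintro (x | x) (y | y) h <;> exact h⟩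
  loopless := ⟨by rintro (x | x) h <;> exact h⟩

/-- The vertex `v₀ ∈ L_𝒯` of the coset `K̃`. -/
def v0 : Vertex := .inl ⟨((1 : GLpi) : BVertex), by rw [sharpB_mk, map_one]⟩

/-! ## The action of the unitary group -/

/-- The group `G_Π = U₃(E_π) = {g | g^* g = I}`. -/
abbrev GPi : Type := Matrix.unitaryGroup (Fin 3) Epi

theorem lattice_mul (g h : GLpi) :
    lattice (g * h) = (lattice h).map (g.val.mulVecLin.restrictScalars Opi) := by
  rw [lattice, lattice, ← Submodule.map_comp]
  congr 1
  ext1 x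
  simp

theorem lattice_mul_lt (g : GLpi) {h k : GLpi} (hk : lattice h < lattice k) :
    lattice (g * h) < lattice (g * k) := by
  rw [lattice_mul, lattice_mul]
  refine Submodule.map_strictMono_of_injective (f := g.val.mulVecLin.restrictScalars Opi) ?_ hk
  intro x y hxy
  have := congrArg (g⁻¹.val.mulVec) hxy
  simpa [Matrix.mulVec_mulVec, ← Units.val_mul] using this

theorem IsChain.smul (g : GLpi) {x y z : BVertex} (h : IsChain x y z) :
    IsChain (g • x) (g • y) (g • z) := by
  obtain ⟨a, b, c, rfl, rfl, rfl, h1, h2, h3⟩ := h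
  refine ⟨g * a, g * b, g * c, rfl, rfl, rfl, ?_, lattice_mul_lt g h2, lattice_mul_lt g h3⟩
  rw [← mul_assoc, scalar_comm, mul_assoc]
  exact lattice_mul_lt g h1

theorem IsTriangle.smul (g : GLpi) {x y z : BVertex} (h : IsTriangle x y z) :
    IsTriangle (g • x) (g • y) (g • z) := by
  obtain ⟨σ, h⟩ := h
  have e : ∀ i, ![g • x, g • y, g • z] i = g • ![x, y, z] i := by
    intro i; fin_cases i <;> rfl
  refine ⟨σ, ?_⟩
  simp only [e]
  exact h.smul g

theorem IsEdge.smul (g : GLpi) {x y : BVertex} (h : IsEdge x y) : IsEdge (g • x) (g • y) := by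
  obtain ⟨z, h⟩ := h
  exact ⟨g • z, h.smul g⟩

/-- `G_Π` acts on the vertices of `ℬ` by left multiplication on cosets. -/
instance : MulAction GPi BVertex := MulAction.compHom BVertex (Unitary.toUnits : GPi →* GLpi)

theorem GPi.smul_def (g : GPi) (x : BVertex) : g • x = Unitary.toUnits g • x := rfl

theorem sharp_toUnits (g : GPi) : sharp (Unitary.toUnits g) = Unitary.toUnits g := by
  change (star (Unitary.toUnits g))⁻¹ = _
  rw [inv_eq_iff_mul_eq_one]
  ext1
  exact Unitary.coe_star_mul_self g

theorem sharpB_smul (g : GPi) (x : BVertex) : sharpB (g • x) = g • sharpB x := by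
  induction x using QuotientGroup.induction_on with
  | H a =>
    change sharpB ((Unitary.toUnits g * a : GLpi) : BVertex) = _
    rw [sharpB_mk, map_mul, sharp_toUnits]
    rfl

instance : MulAction GPi LVertex where
  smul g x := ⟨g • x.1, by rw [sharpB_smul, x.2]⟩
  one_smul x := Subtype.ext (one_smul GPi x.1)
  mul_smul g h x := Subtype.ext (mul_smul g h x.1)

instance : MulAction GPi RVertex where
  smul g e := ⟨e.1.map (g • ·), by
    obtain ⟨_, x, y, rfl, h, hx, hy⟩ := e
    exact ⟨g • x, g • y, rfl, h.smul _, by rw [sharpB_smul, hx], by rw [sharpB_smul, hy]⟩⟩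
  one_smul e := Subtype.ext (by
    change e.1.map ((1 : GPi) • ·) = e.1
    simp)
  mul_smul g h e := Subtype.ext (by
    change e.1.map ((g * h) • ·) = (e.1.map (h • ·)).map (g • ·)
    rw [Sym2.map_map]
    congr 1
    ext1 x
    exact mul_smul g h x)

/-- The embedding of `U₃(E) = {g ∈ GL₃(E) | g^* g = I}` into `G_Π`. -/
def toGPi : Matrix.unitaryGroup (Fin 3) E →* GPi where
  toFun g := ⟨g.1.map (algebraMap E Epi), by
    have h := (Matrix.mem_unitaryGroup_iff').1 g.2
    rw [Matrix.mem_unitaryGroup_iff']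
    have h2 : star (g.1.map (algebraMap E Epi)) = (star g.1).map (algebraMap E Epi) := by
      refine Matrix.ext fun i j => ?_
      exact star_algebraMap _
    rw [h2, ← Matrix.map_mul, h]
    simp⟩
  map_one' := Subtype.ext (by simp)
  map_mul' g h := Subtype.ext (by simp [Matrix.map_mul])

/-- `U₃(E)` acts on the vertices of `𝒯` through its embedding into `G_Π`. -/
instance : MulAction (Matrix.unitaryGroup (Fin 3) E) Vertex := MulAction.compHom Vertex toGPi

/-! ## The group `Γ` and the gates -/

/-- The subring `ℤ[ζ₉, 1/3]` of `E`. -/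
def ringR : Subalgebra ℤ E := Algebra.adjoin ℤ {xi, 1 / 3}

theorem xi_mem_ringR : xi ∈ ringR := Algebra.subset_adjoin (by simp)

theorem third_mem_ringR : (1 / 3 : E) ∈ ringR := Algebra.subset_adjoin (by simp)

theorem star_mem_ringR {x : E} (hx : x ∈ ringR) : star x ∈ ringR := by
  induction hx using Algebra.adjoin_induction with
  | mem x hx =>
    rcases hx with rfl | rfl
    · rw [star_xi]
      exact pow_mem xi_mem_ringR 8
    · have : star (1 / 3 : E) = 1 / 3 := by
        change starRingEnd E (1 / 3) = 1 / 3
        rw [map_div₀, map_one, map_ofNat]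
      rw [this]
      exact third_mem_ringR
  | algebraMap r =>
    have : star (algebraMap ℤ E r) = algebraMap ℤ E r := by simp
    rw [this]
    exact ringR.algebraMap_mem r
  | add x y _ _ hx hy => rw [star_add]; exact add_mem hx hy
  | mul x y _ _ hx hy => rw [star_mul]; exact mul_mem hy hx

/-- The group `Γ` of all unitary `3 × 3` matrices with entries in `ℤ[ζ₉, 1/3]`. -/
def Gam : Subgroup (Matrix.unitaryGroup (Fin 3) E) where
  carrier := {g | ∀ i j, g.1 i j ∈ ringR}
  one_mem' i j := by
    by_cases h : i = j
    · subst h; simp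
    · simp [h]
  mul_mem' {g h} hg hh i j := by
    change (g.1 * h.1) i j ∈ ringR
    rw [Matrix.mul_apply]
    exact sum_mem fun k _ => mul_mem (hg i k) (hh k j)
  inv_mem' {g} hg i j := star_mem_ringR (hg j i)

/-- The matrix of the gate `H`. Here `ζ₃ = ξ³` and `√-3 = ζ₃ - ζ₃²`. -/
def hMatrix : Matrix (Fin 3) (Fin 3) E :=
  (1 / (xi ^ 3 - xi ^ 6)) • !![1, 1, 1; 1, xi ^ 3, xi ^ 6; 1, xi ^ 6, xi ^ 3]

theorem one_div_sqrt : 1 / (xi ^ 3 - xi ^ 6) = (xi ^ 6 - xi ^ 3) / 3 := by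
  have h : (xi ^ 3 - xi ^ 6) * (xi ^ 6 - xi ^ 3) = 3 := by
    linear_combination (-xi ^ 6 + 3 * xi ^ 3 - 3) * xi_sum
  have h0 : xi ^ 3 - xi ^ 6 ≠ 0 := by
    rintro h0
    rw [h0, zero_mul] at h
    norm_num at h
  rw [div_eq_div_iff h0 (by norm_num)]
  linear_combination -h

theorem sqrt_inv_mem_ringR : 1 / (xi ^ 3 - xi ^ 6) ∈ ringR := by
  rw [one_div_sqrt, div_eq_mul_one_div]
  exact mul_mem (sub_mem (pow_mem xi_mem_ringR 6) (pow_mem xi_mem_ringR 3)) third_mem_ringR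

theorem hMatrix_mem : hMatrix ∈ Matrix.unitaryGroup (Fin 3) E := by
  have h3 : star (xi ^ 3) = xi ^ 6 := by
    rw [star_pow, star_xi]
    linear_combination (xi ^ 15 + xi ^ 6) * xi_pow_nine
  have h6 : star (xi ^ 6) = xi ^ 3 := by rw [← h3, star_star]
  have h1 : star (1 : E) = 1 := star_one E
  have hc : star (1 / (xi ^ 3 - xi ^ 6)) * (1 / (xi ^ 3 - xi ^ 6)) = 1 / 3 := by
    have : star (1 / (xi ^ 3 - xi ^ 6)) = -(1 / (xi ^ 3 - xi ^ 6)) := by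
      change starRingEnd E (1 / (xi ^ 3 - xi ^ 6)) = _
      rw [map_div₀, map_one, map_sub]
      change 1 / (star (xi ^ 3) - star (xi ^ 6)) = _
      rw [h3, h6, ← neg_sub, one_div, one_div, inv_neg]
    rw [this, one_div_sqrt]
    linear_combination (xi ^ 6 - 3 * xi ^ 3 + 3) / (-9) * xi_sum
  rw [Matrix.mem_unitaryGroup_iff', Matrix.star_eq_conjTranspose, hMatrix,
    Matrix.conjTranspose_smul, Matrix.smul_mul, Matrix.mul_smul, smul_smul, hc]
  ext i j
  rw [Matrix.smul_apply, Matrix.mul_apply, Fin.sum_univ_three]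
  fin_cases i <;> fin_cases j <;>
    simp [Matrix.conjTranspose_apply, h3, h6, h1] <;>
    first
      | linear_combination xi_sum
      | linear_combination xi_sum + xi ^ 3 * xi_pow_nine
      | linear_combination (2 / 3) * xi_pow_nine
      | norm_num

theorem hMatrix_apply_mem (i j : Fin 3) : hMatrix i j ∈ ringR := by
  rw [hMatrix, Matrix.smul_apply, smul_eq_mul]
  refine mul_mem sqrt_inv_mem_ringR ?_
  fin_cases i <;> fin_cases j <;>
    first | exact one_mem _ | exact pow_mem xi_mem_ringR 3 | exact pow_mem xi_mem_ringR 6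

theorem diagonal_mem (s : Fin 3 → ℤˣ) (a : Fin 3 → ℕ) :
    (Matrix.diagonal fun i => ((s i : ℤ) : E) * xi ^ a i) ∈ Matrix.unitaryGroup (Fin 3) E := by
  rw [Matrix.mem_unitaryGroup_iff', Matrix.star_eq_conjTranspose, Matrix.diagonal_conjTranspose,
    Matrix.diagonal_mul_diagonal, ← Matrix.diagonal_one]
  congr 1
  funext i
  have hs : ((s i : ℤ) : E) * ((s i : ℤ) : E) = 1 := by
    rw [← Int.cast_mul, ← Units.val_mul, Int.units_mul_self]
    simp
  have hx : star xi * xi = 1 := by rw [star_xi, ← pow_succ, xi_pow_nine]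
  rw [Pi.star_apply, star_mul, star_pow, star_intCast]
  calc _ = (star xi * xi) ^ a i * (((s i : ℤ) : E) * ((s i : ℤ) : E)) := by ring
    _ = 1 := by rw [hs, hx, one_pow, one_mul]

theorem diagonal_apply_mem (s : Fin 3 → ℤˣ) (a : Fin 3 → ℕ) (i j : Fin 3) :
    (Matrix.diagonal fun i => ((s i : ℤ) : E) * xi ^ a i) i j ∈ ringR := by
  by_cases h : i = j
  · subst h
    rw [Matrix.diagonal_apply_eq]
    exact mul_mem (intCast_mem ringR _) (pow_mem xi_mem_ringR _)
  · rw [Matrix.diagonal_apply_ne _ h]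
    exact zero_mem _

/-- The gate `H`, an element of `Γ`. -/
def gateH : Gam := ⟨⟨hMatrix, hMatrix_mem⟩, hMatrix_apply_mem⟩

/-- The diagonal gate with diagonal entries `s i * ξ ^ a i`, where `s i = ±1`. -/
def gateDiag (s : Fin 3 → ℤˣ) (a : Fin 3 → ℕ) : Gam :=
  ⟨⟨Matrix.diagonal fun i => ((s i : ℤ) : E) * xi ^ a i, diagonal_mem s a⟩,
    diagonal_apply_mem s a⟩

/-- The set `𝒟` of all matrices `diag(±ζ₉^a, ±ζ₉^b, ±ζ₉^c)`. -/
def gatesD : Set Gam := {g | ∃ s a, g = gateDiag s a}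

/-- The subgroup `Λ = ⟨H, 𝒟⟩` of `Γ`. -/
def Lam : Subgroup Gam := Subgroup.closure ({gateH} ∪ gatesD)

/-! ## Spheres and clans -/

/-- The sphere `S_n(v)` of radius `n ≥ 1` around `v` in `𝒯`. -/
def sphere (n : ℕ) (v : Vertex) : Set Vertex := {u | tree.Reachable v u ∧ tree.dist v u = n}

/-- The `v`-clan of the vertices of `S_6(v)` whose grandfather is `p ∈ S_4(v)`, that is, of the
descendants of `p` two generations further away from `v`. -/
def clan (v p : Vertex) : Set Vertex := {u | u ∈ sphere 6 v ∧ u ∈ sphere 2 p}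

/-- The set of all `v`-clans: two vertices of `S_6(v)` lie in the same `v`-clan if they have a
common grandfather in `S_4(v)`. -/
def clans (v : Vertex) : Set (Set Vertex) := {c | ∃ p ∈ sphere 4 v, c = clan v p}

end CliffordD

end

open scoped NumberField Matrix

noncomputable section

namespace CliffordD

/-! ## Arithmetic of `E_π` -/

/-! The proof is a counting argument in which an upper bound and a lower bound meet at 108. Neither
the regularity of the graph nor the absence of cycles is needed.

Rigidity. An element of `Gam` that moves `v0` by at most 4 fixes `v0` (`smul_v0_eq_of_dist_le`).
Vertices fixed by # are self-dual lattices, and reflected edges are lattices `M` with `π M^# < M <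
M^#`. In this language a walk of length `2k` between two self-dual lattices `L` and `L'` gives `π^k
L' ≤ L`, and conversely such an inclusion gives a walk of length at most `2k` (`walk_lipschitz`,
`exists_walk`). Hence a displacement of at most 4 means that `π² g` is integral at `π`; as 3 is the
only inverted number and `π` the only prime above it, `π² g` then has entries in `ℤ[ξ]`. Replace
`π²` by its associate `delta`. A row of `delta * g` is a vector over `ℤ[ξ]` whose Hermitian norm is
`delta * star delta`. The form `coeffZero (a * star a)` takes natural values on `ℤ[ξ]` and equals 3
at `delta`, so the three entries have lengths adding up to 3. Length 1 would force absolute value 1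
in every embedding, while `delta` has absolute value below 1 in one of them. So the row has a single
nonzero entry, which makes `g` itself integral at `π`, and `g` fixes `v0`.

At most one per clan. Two members of a clan have distance at most 4 through their grandfather, so by
rigidity a clan contains at most one point of the orbit (`eq_of_mem_clan`).

Upper bound. Every vertex has at most four neighbours (`neighborSet_finite`): around a self-dual
lattice they are points of a smooth conic over the field with three elements, around an edge they
are lines in a plane over that field. So `sphere 4 v0` has at most `4 * 27 = 108` points, and there
are at most 108 clans (`sphere_finite`).

Lower bound. The elements `diag(1, ±ξ^a, ±ξ^b) H` with `a < 3` and `b < 9` send `v0` to `2 * 2 * 3 *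
9 = 108` distinct points of `sphere 6 v0` (`gam_smul_injective`, `gam_mem_sphere`). They lie in
different clans, so there are exactly 108 clans and each contains one of these points (`clans_v0`).

Generation. If the distance from `v0` to `g • v0` exceeds 4, take the clan of the fourth vertex on a
geodesic. Its point `gam i • v0` is closer to `g • v0` than `v0` is, so induction on the distance
gives equality of the two orbits (`mem_orbit_Lam`). Everything is then transported from `v0` to its
orbit. -/

theorem valued_algebraMap (x : E) :
    Valued.v (algebraMap E Epi x) = piPlace.valuation E x :=
  IsDedekindDomain.HeightOneSpectrum.valuedAdicCompletion_eq_valuation' piPlace x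

theorem valued_pi : Valued.v (piUnit : Epi) = WithZero.exp (-1 : ℤ) := by
  change Valued.v (algebraMap E Epi (1 - xi)) = _
  rw [valued_algebraMap]
  have h : (1 - xi : E) = algebraMap (𝓞 E) E piInt := by
    simp only [piInt, map_sub, map_one]
    rfl
  rw [h, piPlace.valuation_of_algebraMap, piPlace.intValuation_singleton prime_piInt.ne_zero rfl]

/-- The normalized additive valuation of `E_π`. -/
def ord (c : Epiˣ) : ℤ := -WithZero.log (Valued.v (c : Epi))

theorem valued_unit_ne_zero (c : Epiˣ) : (Valued.v (c : Epi) : WithZero (Multiplicative ℤ)) ≠ 0 :=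
  (Valuation.ne_zero_iff _).2 c.ne_zero

theorem ord_mul (c d : Epiˣ) : ord (c * d) = ord c + ord d := by
  simp only [ord, Units.val_mul, map_mul]
  rw [WithZero.log_mul (valued_unit_ne_zero c) (valued_unit_ne_zero d)]
  ring

theorem ord_one : ord 1 = 0 := by simp [ord]

/-- `ord` as a homomorphism. -/
def ordHom : Epiˣ →* Multiplicative ℤ where
  toFun c := Multiplicative.ofAdd (ord c)
  map_one' := by rw [ord_one]; rfl
  map_mul' c d := by rw [ord_mul]; rfl

theorem ord_inv (c : Epiˣ) : ord c⁻¹ = -ord c := by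
  have := ord_mul c c⁻¹
  rw [mul_inv_cancel, ord_one] at this
  linarith

theorem ord_zpow (c : Epiˣ) (n : ℤ) : ord (c ^ n) = n * ord c := by
  have := map_zpow ordHom c n
  have h := congrArg Multiplicative.toAdd this
  rw [toAdd_zpow] at h
  simpa [ordHom] using h

theorem ord_pow (c : Epiˣ) (n : ℕ) : ord (c ^ n) = n * ord c := by
  have := ord_zpow c n
  simpa using this

theorem ord_pi : ord piUnit = 1 := by
  rw [ord, valued_pi, WithZero.log_exp]; rfl

theorem unit_mem_Opi_iff (c : Epiˣ) : (c : Epi) ∈ Opi ↔ 0 ≤ ord c := by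
  rw [IsDedekindDomain.HeightOneSpectrum.mem_adicCompletionIntegers, ord]
  rw [← WithZero.log_le_log (valued_unit_ne_zero c) one_ne_zero, WithZero.log_one]
  constructor <;> intro h <;> linarith

theorem ord_eq_zero_iff (c : Epiˣ) : ord c = 0 ↔ (c : Epi) ∈ Opi ∧ ((c⁻¹ : Epiˣ) : Epi) ∈ Opi := by
  rw [unit_mem_Opi_iff, unit_mem_Opi_iff, ord_inv]
  constructor
  · intro h; constructor <;> linarith
  · rintro ⟨h1, h2⟩; linarith

theorem ord_star (c : Epiˣ) : ord (star c) = ord c := by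
  have key : ∀ d : Epiˣ, ord d = 0 → ord (star d) = 0 := by
    intro d hd
    rw [ord_eq_zero_iff] at hd ⊢
    exact ⟨star_mem_Opi hd.1, by simpa using star_mem_Opi hd.2⟩
  have hpi : ord (star piUnit) = 1 := by
    have h1 : (0 : ℤ) ≤ ord (star piUnit) := by
      rw [← unit_mem_Opi_iff]
      exact star_mem_Opi ((unit_mem_Opi_iff _).2 (by rw [ord_pi]; norm_num))
    have h : (star piUnit : Epiˣ) = piUnit ^ (ord (star piUnit)) *
      (piUnit ^ (-ord (star piUnit)) * star piUnit) := by
      rw [← mul_assoc, ← zpow_add]; simp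
    have h2 := congrArg star h
    rw [star_star, star_mul] at h2
    have h3 := congrArg ord h2
    have h4 : star (piUnit ^ ord (star piUnit)) = (star piUnit) ^ ord (star piUnit) := by
      rw [star_zpow]
    rw [ord_mul, ord_pi, h4, ord_zpow] at h3
    rw [key _ (by rw [ord_mul, ord_zpow, ord_pi]; ring)] at h3
    -- Conjugating twice gives `n * n = 1` for `n = ord (star piUnit) ≥ 0`.
    nlinarith
  have h : star c = star piUnit ^ ord c * star (piUnit ^ (-ord c) * c) := by
    rw [star_mul, star_zpow, mul_comm (star c), ← mul_assoc, ← zpow_add]; simp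
  rw [h, ord_mul, ord_zpow, hpi, key _ (by rw [ord_mul, ord_zpow, ord_pi]; ring)]
  ring

/-! ### The residue field -/

/-- `x ≡ n` modulo `π`. -/
def CongInt (x : Epi) (n : ℤ) : Prop := ((piUnit⁻¹ : Epiˣ) : Epi) * (x - n) ∈ Opi

theorem pi_mem_Opi : (piUnit : Epi) ∈ Opi := (unit_mem_Opi_iff _).2 (by rw [ord_pi]; norm_num)

theorem pi_inv_notMem_Opi : ((piUnit⁻¹ : Epiˣ) : Epi) ∉ Opi := by
  rw [unit_mem_Opi_iff, ord_inv, ord_pi]; norm_num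

theorem mem_pi_iff {x : Epi} : ((piUnit⁻¹ : Epiˣ) : Epi) * x ∈ Opi ↔ Valued.v x < 1 := by
  by_cases hx : x = 0
  · simp [hx]
  have h0 : (Valued.v x : WithZero (Multiplicative ℤ)) ≠ 0 := (Valuation.ne_zero_iff _).2 hx
  have := unit_mem_Opi_iff (piUnit⁻¹ * Units.mk0 x hx)
  rw [Units.val_mul, Units.val_mk0] at this
  rw [this, ord_mul, ord_inv, ord_pi, ord, Units.val_mk0,
    ← WithZero.log_lt_log h0 one_ne_zero, WithZero.log_one]
  constructor <;> intro h <;> linarith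

theorem three_eq : (3 : E) = (1 - xi) * ((1 + xi + xi ^ 2) * (1 - xi ^ 6)) := by
  linear_combination xi_sum - xi_pow_nine

theorem mem_adjoin_xi (x : 𝓞 E) : (x : E) ∈ Algebra.adjoin ℤ {xi} := by
  have := IsCyclotomicExtension.Rat.isIntegralClosure_adjoin_singleton xi_spec
  obtain ⟨y, hy⟩ := this.isIntegral_iff.1 x.2
  have h : (y : E) = (x : E) := hy
  rw [← h]
  exact y.2

theorem exists_int_add_pi_mul {x : E} (hx : x ∈ Algebra.adjoin ℤ {xi}) :
    ∃ n : ℤ, ∃ y ∈ Algebra.adjoin ℤ {xi}, x = n + (1 - xi) * y := by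
  have hxi : xi ∈ Algebra.adjoin ℤ {xi} := Algebra.subset_adjoin rfl
  have h1 : (1 - xi) ∈ Algebra.adjoin ℤ {xi} := sub_mem (one_mem _) hxi
  induction hx using Algebra.adjoin_induction with
  | mem x hx =>
    rw [Set.mem_singleton_iff] at hx
    subst hx
    exact ⟨1, -1, neg_mem (one_mem _), by push_cast; ring⟩
  | algebraMap r => exact ⟨r, 0, zero_mem _, by simp⟩
  | add x y _ _ hx hy =>
    obtain ⟨n, a, ha, rfl⟩ := hx
    obtain ⟨m, b, hb, rfl⟩ := hy
    exact ⟨n + m, a + b, add_mem ha hb, by push_cast; ring⟩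
  | mul x y _ _ hx hy =>
    obtain ⟨n, a, ha, rfl⟩ := hx
    obtain ⟨m, b, hb, rfl⟩ := hy
    refine ⟨n * m, n * b + m * a + (1 - xi) * (a * b), ?_, by push_cast; ring⟩
    exact add_mem (add_mem (mul_mem (intCast_mem _ _) hb) (mul_mem (intCast_mem _ _) ha))
      (mul_mem h1 (mul_mem ha hb))

theorem adjoin_xi_integral {x : E} (hx : x ∈ Algebra.adjoin ℤ {xi}) :
    ∃ y : 𝓞 E, (y : E) = x := by
  have h : Algebra.adjoin ℤ {xi} ≤ integralClosure ℤ E := by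
    rw [Algebra.adjoin_le_iff, Set.singleton_subset_iff]
    exact xi_spec.isIntegral (by norm_num)
  exact ⟨⟨x, h hx⟩, rfl⟩

theorem algebraMap_int_mem (y : 𝓞 E) : algebraMap E Epi (y : E) ∈ Opi :=
  IsDedekindDomain.HeightOneSpectrum.coe_mem_adicCompletionIntegers (K := E) piPlace y

/-- Density of `E` in `E_π`, and then approximation by integers of `E`, reduce this to `ℤ[ξ]`, where
`ξ ≡ 1` modulo `π`. -/
theorem exists_congInt {x : Epi} (hx : x ∈ Opi) : ∃ n : ℤ, CongInt x n := by
  have hball : IsOpen {y : Epi | Valued.v (y - x) < 1} := by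
    have h1 : IsOpen {z : Epi | Valued.v z < 1} := by
      have := Valued.isOpen_ball (R := Epi) (Γ₀ := WithZero (Multiplicative ℤ)) 1
      simpa using this
    exact h1.preimage (by fun_prop : Continuous fun y : Epi => y - x)
  obtain ⟨a, ha⟩ := (IsDedekindDomain.HeightOneSpectrum.denseRange_algebraMap
    (K := E) (v := piPlace)).exists_mem_open hball ⟨x, by simp⟩
  have hav : piPlace.valuation E a ≤ 1 := by
    rw [← valued_algebraMap]
    have := Valuation.map_add (Valued.v : Valuation Epi (WithZero (Multiplicative ℤ)))
      (algebraMap E Epi a - x) x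
    rw [sub_add_cancel] at this
    exact this.trans (max_le (le_of_lt ha) hx)
  obtain ⟨r, hr⟩ := piPlace.exists_valuation_sub_lt_of_integer (K := E) hav 1
  obtain ⟨n, y, hy, hry⟩ := exists_int_add_pi_mul (mem_adjoin_xi r)
  obtain ⟨y, rfl⟩ := adjoin_xi_integral hy
  refine ⟨n, ?_⟩
  have e : x - (n : Epi) = -(algebraMap E Epi a - x) - algebraMap E Epi ((r : E) - a) +
      algebraMap E Epi ((r : E) - n) := by
    simp only [map_sub, map_intCast]
    ring
  have h1 : ((piUnit⁻¹ : Epiˣ) : Epi) * (algebraMap E Epi a - x) ∈ Opi := mem_pi_iff.2 ha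
  have h2 : ((piUnit⁻¹ : Epiˣ) : Epi) * algebraMap E Epi ((r : E) - a) ∈ Opi := by
    rw [mem_pi_iff, valued_algebraMap]
    simpa using hr
  have h3 : ((piUnit⁻¹ : Epiˣ) : Epi) * algebraMap E Epi ((r : E) - n) ∈ Opi := by
    rw [hry, add_sub_cancel_left, map_mul, ← mul_assoc]
    have : ((piUnit⁻¹ : Epiˣ) : Epi) * algebraMap E Epi (1 - xi) = 1 := Units.inv_mul piUnit
    rw [this, one_mul]
    exact algebraMap_int_mem y
  rw [CongInt, e, mul_add, mul_sub, mul_neg]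
  exact add_mem (sub_mem (neg_mem h1) h2) h3

theorem congInt_three : CongInt 3 0 := by
  have : ((piUnit⁻¹ : Epiˣ) : Epi) * algebraMap E Epi (1 - xi) = 1 := Units.inv_mul piUnit
  rw [CongInt, Int.cast_zero, sub_zero]
  have h3 : (3 : Epi) = algebraMap E Epi 3 := (map_ofNat (algebraMap E Epi) 3).symm
  rw [h3, three_eq, map_mul, ← mul_assoc, this, one_mul]
  have hxi : xi ∈ Algebra.adjoin ℤ {xi} := Algebra.subset_adjoin rfl
  obtain ⟨y, hy⟩ := adjoin_xi_integral (x := (1 + xi + xi ^ 2) * (1 - xi ^ 6))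
    (mul_mem (add_mem (add_mem (one_mem _) hxi) (pow_mem hxi 2)) (sub_mem (one_mem _) (pow_mem hxi 6)))
  rw [← hy]
  exact algebraMap_int_mem y

theorem CongInt.add {x y : Epi} {n m : ℤ} (hx : CongInt x n) (hy : CongInt y m) :
    CongInt (x + y) (n + m) := by
  have := add_mem hx hy
  rw [← mul_add] at this
  rw [CongInt]
  convert this using 2
  push_cast
  ring

theorem CongInt.neg {x : Epi} {n : ℤ} (hx : CongInt x n) : CongInt (-x) (-n) := by
  have := neg_mem hx
  rw [← mul_neg] at this
  rw [CongInt]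
  convert this using 2
  push_cast
  ring

theorem intCast_mem_Opi (n : ℤ) : (n : Epi) ∈ Opi := intCast_mem _ n

theorem CongInt.mul {x y : Epi} {n m : ℤ} (hxO : x ∈ Opi) (hx : CongInt x n)
    (hy : CongInt y m) : CongInt (x * y) (n * m) := by
  have := add_mem (mul_mem hxO hy) (mul_mem (intCast_mem_Opi m) hx)
  rw [CongInt]
  convert this using 1
  push_cast
  ring

theorem congInt_intCast (n : ℤ) : CongInt n n := by
  rw [CongInt, sub_self, mul_zero]; exact zero_mem _

/-- If 3 does not divide `n`, a Bézout relation between 3 and `n` would give `1 ≡ 0` modulo `π`.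
This identifies the residue field with `ZMod 3`. -/
theorem congInt_zero_iff {n : ℤ} : CongInt n 0 ↔ (3 : ℤ) ∣ n := by
  have h3 := congInt_three
  constructor
  · intro h
    by_contra hn
    have hc : IsCoprime (3 : ℤ) n := (Int.prime_three.coprime_iff_not_dvd).2 hn
    obtain ⟨a, b, hab⟩ := hc
    have h1 := ((congInt_intCast a).mul (intCast_mem_Opi a) h3).add
      ((congInt_intCast b).mul (intCast_mem_Opi b) h)
    have e : ((a : Epi) * 3 + b * n) = 1 := by exact_mod_cast congrArg (Int.cast (R := Epi)) hab
    rw [e, CongInt] at h1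
    simp only [mul_zero, add_zero, Int.cast_zero, sub_zero, mul_one] at h1
    exact pi_inv_notMem_Opi h1
  · rintro ⟨m, rfl⟩
    have := (congInt_intCast m).mul (intCast_mem_Opi m) h3
    rw [mul_comm, mul_zero] at this
    simpa using this

theorem CongInt.zmod_eq {x : Epi} {n m : ℤ} (hn : CongInt x n) (hm : CongInt x m) :
    (n : ZMod 3) = m := by
  have h := hn.add hm.neg
  have h2 : CongInt ((m - n : ℤ) : Epi) 0 := by
    rw [CongInt] at h ⊢
    convert h using 2
    push_cast
    ring
  rw [congInt_zero_iff] at h2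
  exact (ZMod.intCast_eq_intCast_iff_dvd_sub n m 3).2 h2

/-- The reduction `O_{E_π} → O_{E_π} / π = 𝔽₃`. -/
def red : Opi →+* ZMod 3 where
  toFun x := ((exists_congInt x.2).choose : ZMod 3)
  map_one' := by
    have := (exists_congInt (1 : Opi).2).choose_spec.zmod_eq (m := 1) (by
      simpa using congInt_intCast 1)
    simpa using this
  map_zero' := by
    have := (exists_congInt (0 : Opi).2).choose_spec.zmod_eq (m := 0) (by
      simpa using congInt_intCast 0)
    simpa using this
  map_mul' x y := by
    have := (exists_congInt (x * y).2).choose_spec.zmod_eq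
      ((exists_congInt x.2).choose_spec.mul x.2 (exists_congInt y.2).choose_spec)
    simpa using this
  map_add' x y := by
    have := (exists_congInt (x + y).2).choose_spec.zmod_eq
      ((exists_congInt x.2).choose_spec.add (exists_congInt y.2).choose_spec)
    simpa using this

theorem congInt_red (x : Opi) : ∃ n : ℤ, CongInt (x : Epi) n ∧ red x = n :=
  ⟨_, (exists_congInt x.2).choose_spec, rfl⟩

theorem red_eq_zero_iff (x : Opi) : red x = 0 ↔ ((piUnit⁻¹ : Epiˣ) : Epi) * x ∈ Opi := by
  obtain ⟨n, hn, h⟩ := congInt_red x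
  rw [h, ZMod.intCast_zmod_eq_zero_iff_dvd]
  have h0 : ((piUnit⁻¹ : Epiˣ) : Epi) * x ∈ Opi ↔ CongInt (x : Epi) 0 := by
    simp [CongInt]
  rw [h0]
  constructor
  · intro h3
    have := hn.add ((congInt_intCast n).neg)
    have h4 := this.add (congInt_zero_iff.2 h3)
    simpa using h4
  · intro h1
    have := hn.zmod_eq h1
    rw [Int.cast_zero] at this
    exact (ZMod.intCast_zmod_eq_zero_iff_dvd n 3).1 this

theorem red_intCast (n : ℤ) : red n = n := map_intCast red n

theorem red_surjective : Function.Surjective red := by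
  intro a
  obtain ⟨n, rfl⟩ := ZMod.intCast_surjective a
  exact ⟨n, red_intCast n⟩

theorem isUnit_iff_red_ne_zero (x : Opi) : IsUnit x ↔ red x ≠ 0 := by
  constructor
  · intro h
    exact (h.map red).ne_zero
  · intro h
    rw [Ne, red_eq_zero_iff, mem_pi_iff] at h
    rw [IsDedekindDomain.HeightOneSpectrum.adicCompletionIntegers.isUnit_iff_valued_eq_one]
    exact le_antisymm x.2 (not_lt.1 h)

theorem star_pi_mul_mem {x : Epi} :
    ((piUnit⁻¹ : Epiˣ) : Epi) * star x ∈ Opi ↔ ((piUnit⁻¹ : Epiˣ) : Epi) * x ∈ Opi := by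
  by_cases hx : x = 0
  · simp [hx]
  have h1 := unit_mem_Opi_iff (piUnit⁻¹ * Units.mk0 x hx)
  have h2 := unit_mem_Opi_iff (piUnit⁻¹ * star (Units.mk0 x hx))
  rw [ord_mul, ord_star, ← ord_mul, ← h1] at h2
  exact h2

/-- Residue classes are represented by rational integers, which conjugation fixes. Consequently
Hermitian forms reduce to symmetric bilinear forms modulo `π`. -/
theorem red_conjOpi (x : Opi) : red (conjOpi x) = red x := by
  obtain ⟨n, hn, h⟩ := congInt_red x
  obtain ⟨m, hm, h'⟩ := congInt_red (conjOpi x)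
  rw [h, h']
  refine hm.zmod_eq ?_
  rw [CongInt]
  have : ((conjOpi x : Opi) : Epi) - n = star ((x : Epi) - n) := by
    rw [star_sub, star_intCast]
    rfl
  rw [this, star_pi_mul_mem]
  exact hn

/-! ## Lattices in `E_π³` -/

open scoped Pointwise

/-- The space `E_π³`. -/
abbrev V : Type := Fin 3 → Epi

/-- The `O_{E_π}`-submodules of `E_π³`. -/
abbrev OSub : Type := Submodule Opi V

theorem mem_lattice {g : GLpi} {x : V} :
    x ∈ lattice g ↔ ∀ i, (g⁻¹.val *ᵥ x) i ∈ Opi := by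
  rw [lattice, Submodule.mem_map]
  constructor
  · rintro ⟨y, ⟨z, rfl⟩, rfl⟩ i
    have : g⁻¹.val *ᵥ (g.val *ᵥ ((Algebra.linearMap Opi Epi).compLeft (Fin 3) z)) =
        (Algebra.linearMap Opi Epi).compLeft (Fin 3) z := by
      rw [Matrix.mulVec_mulVec, ← Units.val_mul, inv_mul_cancel, Units.val_one, Matrix.one_mulVec]
    change (g⁻¹.val *ᵥ (g.val *ᵥ ((Algebra.linearMap Opi Epi).compLeft (Fin 3) z))) i ∈ Opi
    rw [this]
    exact (z i).2
  · intro h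
    refine ⟨g⁻¹.val *ᵥ x, ⟨fun i => ⟨_, h i⟩, rfl⟩, ?_⟩
    change g.val *ᵥ (g⁻¹.val *ᵥ x) = x
    rw [Matrix.mulVec_mulVec, ← Units.val_mul, mul_inv_cancel, Units.val_one, Matrix.one_mulVec]

theorem mem_smul_iff {c : Epiˣ} {N : OSub} {x : V} : x ∈ c • N ↔ c⁻¹ • x ∈ N := by
  change x ∈ (c : Epi) • N ↔ _
  rw [Submodule.mem_smul_pointwise_iff_exists]
  constructor
  · rintro ⟨y, hy, rfl⟩
    rwa [← Units.smul_def, inv_smul_smul]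
  · intro h
    exact ⟨_, h, by rw [← Units.smul_def, smul_inv_smul]⟩

theorem smul_le_smul_iff {c : Epiˣ} {N P : OSub} : c • N ≤ c • P ↔ N ≤ P := by
  constructor
  · intro h x hx
    have := h (x := c • x) (mem_smul_iff.2 (by simpa using hx))
    simpa using mem_smul_iff.1 this
  · intro h x hx
    exact mem_smul_iff.2 (h (mem_smul_iff.1 hx))

theorem smul_lt_smul_iff {c : Epiˣ} {N P : OSub} : c • N < c • P ↔ N < P := by
  rw [lt_iff_le_not_ge, lt_iff_le_not_ge, smul_le_smul_iff, smul_le_smul_iff]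

theorem smul_le_of_nonneg {c : Epiˣ} (hc : 0 ≤ ord c) (N : OSub) : c • N ≤ N := by
  intro x hx
  rw [mem_smul_iff] at hx
  have := N.smul_mem (⟨c, (unit_mem_Opi_iff c).2 hc⟩ : Opi) hx
  have e : (⟨c, (unit_mem_Opi_iff c).2 hc⟩ : Opi) • (c⁻¹ • x) = x := by
    change (c : Epi) • (c⁻¹ • x) = x
    rw [← Units.smul_def, smul_inv_smul]
  rwa [e] at this

theorem smul_le_smul_of_ord_le {c d : Epiˣ} (h : ord d ≤ ord c) (N : OSub) : c • N ≤ d • N := by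
  have := smul_le_of_nonneg (c := d⁻¹ * c) (by rw [ord_mul, ord_inv]; linarith) N
  rw [← smul_le_smul_iff (c := d), smul_smul, mul_inv_cancel_left] at this
  exact this

theorem smul_eq_of_ord_eq {c d : Epiˣ} (h : ord c = ord d) (N : OSub) : c • N = d • N :=
  le_antisymm (smul_le_smul_of_ord_le h.ge N) (smul_le_smul_of_ord_le h.le N)

theorem lattice_scalar_mul (c : Epiˣ) (g : GLpi) :
    lattice (Matrix.GeneralLinearGroup.scalar (Fin 3) c * g) = c • lattice g := by
  ext x
  rw [mem_smul_iff, mem_lattice, mem_lattice]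
  have : (Matrix.GeneralLinearGroup.scalar (Fin 3) c * g)⁻¹.val *ᵥ x = g⁻¹.val *ᵥ (c⁻¹ • x) := by
    rw [mul_inv_rev, ← map_inv, Units.val_mul, ← Matrix.mulVec_mulVec]
    congr 1
    change Matrix.scalar (Fin 3) ((c⁻¹ : Epiˣ) : Epi) *ᵥ x = _
    ext i
    simp [Matrix.scalar_apply, Matrix.mulVec_diagonal, Units.smul_def]
  rw [this]

/-- A submodule of the form `g O³`. -/
def IsLat (N : OSub) : Prop := ∃ g, lattice g = N

theorem IsLat.smul {N : OSub} (h : IsLat N) (c : Epiˣ) : IsLat (c • N) := by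
  obtain ⟨g, rfl⟩ := h
  exact ⟨_, lattice_scalar_mul c g⟩

theorem exists_eq_map {g : GLpi} (h1 : ∀ i j, g.val i j ∈ Opi) (h2 : ∀ i j, g⁻¹.val i j ∈ Opi) :
    ∃ k : GL (Fin 3) Opi, g = Matrix.GeneralLinearGroup.map Opi.subtype k := by
  have inj : Function.Injective fun M : Matrix (Fin 3) (Fin 3) Opi => M.map Opi.subtype :=
    Matrix.map_injective Subtype.val_injective
  let a : Matrix (Fin 3) (Fin 3) Opi := fun i j => ⟨_, h1 i j⟩
  let b : Matrix (Fin 3) (Fin 3) Opi := fun i j => ⟨_, h2 i j⟩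
  have ha : a.map Opi.subtype = g.val := rfl
  have hb : b.map Opi.subtype = g⁻¹.val := rfl
  refine ⟨⟨a, b, ?_, ?_⟩, ?_⟩
  · apply inj
    change (a * b).map Opi.subtype = (1 : Matrix (Fin 3) (Fin 3) Opi).map Opi.subtype
    rw [Matrix.map_mul, ha, hb, ← Units.val_mul, mul_inv_cancel]
    simp
  · apply inj
    change (b * a).map Opi.subtype = (1 : Matrix (Fin 3) (Fin 3) Opi).map Opi.subtype
    rw [Matrix.map_mul, ha, hb, ← Units.val_mul, inv_mul_cancel]
    simp
  · ext1
    exact ha.symm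

theorem lattice_le_iff {g h : GLpi} : lattice h ≤ lattice g ↔ ∀ i j, (g⁻¹ * h).val i j ∈ Opi := by
  constructor
  · intro hl i j
    have h1 : h.val *ᵥ Pi.single j 1 ∈ lattice h := by
      rw [mem_lattice]
      intro l
      rw [Matrix.mulVec_mulVec, ← Units.val_mul, inv_mul_cancel, Units.val_one, Matrix.one_mulVec]
      by_cases hlj : l = j
      · subst hlj; simp [one_mem]
      · simp [hlj, zero_mem]
    have h2 := mem_lattice.1 (hl h1) i
    rw [Matrix.mulVec_mulVec, Matrix.mulVec_single_one] at h2
    exact h2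
  · intro hO x hx
    rw [mem_lattice] at hx ⊢
    intro i
    have e : g⁻¹.val *ᵥ x = (g⁻¹ * h).val *ᵥ (h⁻¹.val *ᵥ x) := by
      rw [Matrix.mulVec_mulVec, ← Units.val_mul, mul_inv_cancel_right]
    rw [e]
    exact sum_mem fun j _ => mul_mem (hO i j) (hx j)

theorem lattice_eq_iff {g h : GLpi} :
    lattice g = lattice h ↔ ∃ k : GL (Fin 3) Opi, h = g * Matrix.GeneralLinearGroup.map Opi.subtype k := by
  constructor
  · intro hl
    obtain ⟨k, hk⟩ := exists_eq_map (g := g⁻¹ * h) (lattice_le_iff.1 hl.ge)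
      (by rw [mul_inv_rev, inv_inv]; exact lattice_le_iff.1 hl.le)
    exact ⟨k, by rw [← hk, mul_inv_cancel_left]⟩
  · rintro ⟨k, rfl⟩
    apply le_antisymm
    · rw [lattice_le_iff, mul_inv_rev, inv_mul_cancel_right, ← map_inv]
      exact fun i j => (k⁻¹.val i j).2
    · rw [lattice_le_iff, inv_mul_cancel_left]
      exact fun i j => (k.val i j).2

/-- The dictionary between cosets and homothety classes of lattices: integral invertible factors
preserve the lattice, scalars rescale it. -/
theorem mk_eq_iff {g h : GLpi} : (g : BVertex) = h ↔ ∃ c : Epiˣ, lattice h = c • lattice g := by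
  rw [QuotientGroup.eq]
  constructor
  · rintro ⟨c, k, hk⟩
    refine ⟨c, ?_⟩
    rw [← lattice_scalar_mul, eq_comm, lattice_eq_iff]
    refine ⟨k, ?_⟩
    rw [scalar_comm, mul_assoc, ← hk, mul_inv_cancel_left]
  · rintro ⟨c, hc⟩
    rw [← lattice_scalar_mul, eq_comm, lattice_eq_iff] at hc
    obtain ⟨k, rfl⟩ := hc
    refine ⟨c, k, ?_⟩
    rw [scalar_comm, mul_assoc, inv_mul_cancel_left]

theorem mk_eq_of_lattice_eq {g h : GLpi} (e : lattice g = lattice h) : (g : BVertex) = h :=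
  mk_eq_iff.2 ⟨1, by rw [one_smul, e]⟩

/-! ### The valuation of the determinant -/

/-- The valuation of the determinant. -/
def odet (g : GLpi) : ℤ := ord (Matrix.GeneralLinearGroup.det g)

theorem odet_mul (g h : GLpi) : odet (g * h) = odet g + odet h := by
  rw [odet, map_mul, ord_mul]; rfl

theorem odet_scalar (c : Epiˣ) : odet (Matrix.GeneralLinearGroup.scalar (Fin 3) c) = 3 * ord c := by
  have : Matrix.GeneralLinearGroup.det (Matrix.GeneralLinearGroup.scalar (Fin 3) c) = c ^ 3 := by
    ext1
    change (Matrix.scalar (Fin 3) (c : Epi)).det = _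
    simp
  rw [odet, this, ord_pow]
  norm_num

theorem odet_map (k : GL (Fin 3) Opi) : odet (Matrix.GeneralLinearGroup.map Opi.subtype k) = 0 := by
  have hh : ∀ k : GL (Fin 3) Opi, ((Matrix.GeneralLinearGroup.det
      (Matrix.GeneralLinearGroup.map Opi.subtype k) : Epiˣ) : Epi) ∈ Opi := by
    intro k
    have : ((Matrix.GeneralLinearGroup.det (Matrix.GeneralLinearGroup.map Opi.subtype k) : Epiˣ) :
      Epi) = Opi.subtype k.val.det := by
      rw [RingHom.map_det]; rfl
    rw [this]
    exact k.val.det.2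
  rw [odet, ord_eq_zero_iff]
  refine ⟨hh k, ?_⟩
  rw [← map_inv, ← map_inv]
  exact hh k⁻¹

theorem odet_sharp (g : GLpi) : odet (sharp g) = -odet g := by
  have : Matrix.GeneralLinearGroup.det (sharp g) = (star (Matrix.GeneralLinearGroup.det g))⁻¹ := by
    change Matrix.GeneralLinearGroup.det (star g)⁻¹ = _
    rw [map_inv]
    congr 1
    ext1
    exact Matrix.det_conjTranspose g.val
  rw [odet, this, ord_inv, ord_star]; rfl

theorem odet_eq_of_lattice_eq {g h : GLpi} {c : Epiˣ} (e : lattice h = c • lattice g) :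
    odet h = 3 * ord c + odet g := by
  rw [← lattice_scalar_mul, eq_comm, lattice_eq_iff] at e
  obtain ⟨k, rfl⟩ := e
  rw [odet_mul, odet_mul, odet_scalar, odet_map, add_zero]

/-! ### Duality -/

/-- The Hermitian form. -/
def hf (x y : V) : Epi := star x ⬝ᵥ y

theorem hf_add_right (x y z : V) : hf x (y + z) = hf x y + hf x z := dotProduct_add _ _ _

theorem hf_add_left (x y z : V) : hf (x + y) z = hf x z + hf y z := by
  rw [hf, star_add, add_dotProduct]; rfl

theorem hf_smul_right (x : V) (c : Epi) (y : V) : hf x (c • y) = c * hf x y := by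
  rw [hf, dotProduct_smul]; rfl

theorem hf_smul_left (x : V) (c : Epi) (y : V) : hf (c • x) y = star c * hf x y := by
  rw [hf, star_smul, smul_dotProduct]; rfl

theorem hf_mulVec (x y : V) (g : Matrix (Fin 3) (Fin 3) Epi) : hf (g *ᵥ x) y = hf x (gᴴ *ᵥ y) := by
  rw [hf, hf, Matrix.star_mulVec, Matrix.dotProduct_mulVec]

/-- The dual lattice with respect to the Hermitian form. -/
def dual (N : OSub) : OSub where
  carrier := {x | ∀ y ∈ N, hf y x ∈ Opi}
  add_mem' ha hb y hy := by rw [hf_add_right]; exact add_mem (ha y hy) (hb y hy)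
  zero_mem' y _ := by rw [hf, dotProduct_zero]; exact zero_mem _
  smul_mem' c x hx y hy := by
    change hf y ((c : Epi) • x) ∈ Opi
    rw [hf_smul_right]
    exact mul_mem c.2 (hx y hy)

theorem mem_dual {N : OSub} {x : V} : x ∈ dual N ↔ ∀ y ∈ N, hf y x ∈ Opi := Iff.rfl

theorem dual_anti {N P : OSub} (h : N ≤ P) : dual P ≤ dual N := fun _ hx y hy => hx y (h hy)

theorem dual_sup (N P : OSub) : dual (N ⊔ P) = dual N ⊓ dual P := by
  refine le_antisymm (le_inf (dual_anti le_sup_left) (dual_anti le_sup_right)) ?_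
  rintro x ⟨h1, h2⟩ y hy
  obtain ⟨a, ha, b, hb, rfl⟩ := Submodule.mem_sup.1 hy
  rw [hf_add_left]
  exact add_mem (h1 a ha) (h2 b hb)

theorem dual_smul (c : Epiˣ) (N : OSub) : dual (c • N) = c⁻¹ • dual N := by
  -- Duality naturally produces the conjugate of `c`; it may be exchanged for `c` because rescaling
  -- a submodule depends only on `ord`.
  rw [smul_eq_of_ord_eq (c := c⁻¹) (d := (star c)⁻¹) (by rw [ord_inv, ord_inv, ord_star])]
  ext x
  rw [mem_smul_iff, inv_inv, mem_dual, mem_dual]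
  constructor
  · intro h y hy
    have := h (c • y) (mem_smul_iff.2 (by simpa using hy))
    rw [Units.smul_def, hf_smul_left] at this
    rw [Units.smul_def, hf_smul_right]
    exact this
  · intro h y hy
    have := h _ (mem_smul_iff.1 hy)
    rw [Units.smul_def (star c), hf_smul_right] at this
    have e : y = (c : Epi) • (c⁻¹ • y) := by rw [← Units.smul_def, smul_inv_smul]
    rw [e, hf_smul_left]
    exact this

/-- Testing `x` against the columns of `g` is the same as asking that `g^* x` be integral. Thus #
becomes lattice duality. -/
theorem dual_lattice (g : GLpi) : dual (lattice g) = lattice (sharp g) := by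
  have hinv : (sharp g)⁻¹.val = g.valᴴ := by
    change ((star g)⁻¹)⁻¹.val = _
    rw [inv_inv]; rfl
  ext x
  rw [mem_lattice, hinv]
  constructor
  · intro h i
    have h1 : g.val *ᵥ Pi.single i 1 ∈ lattice g := by
      rw [mem_lattice]
      intro l
      rw [Matrix.mulVec_mulVec, ← Units.val_mul, inv_mul_cancel, Units.val_one, Matrix.one_mulVec]
      by_cases hlj : l = i
      · subst hlj; simp [one_mem]
      · simp [hlj, zero_mem]
    have h2 := h _ h1
    rw [hf_mulVec, hf] at h2
    simpa [← Pi.single_star] using h2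
  · intro h y hy
    have e : y = g.val *ᵥ (g⁻¹.val *ᵥ y) := by
      rw [Matrix.mulVec_mulVec, ← Units.val_mul, mul_inv_cancel, Units.val_one, Matrix.one_mulVec]
    rw [e, hf_mulVec]
    exact sum_mem fun i _ => mul_mem (star_mem_Opi (mem_lattice.1 hy i)) (h i)

theorem sharp_sharp (g : GLpi) : sharp (sharp g) = g := by
  change (star (star g)⁻¹)⁻¹ = g
  rw [star_inv, star_star, inv_inv]

theorem IsLat.dual {N : OSub} (h : IsLat N) : IsLat (dual N) := by
  obtain ⟨g, rfl⟩ := h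
  exact ⟨_, (dual_lattice g).symm⟩

theorem IsLat.dual_dual {N : OSub} (h : IsLat N) : CliffordD.dual (CliffordD.dual N) = N := by
  obtain ⟨g, rfl⟩ := h
  rw [dual_lattice, dual_lattice, sharp_sharp]

theorem IsLat.dual_le_iff {N P : OSub} (hN : IsLat N) (hP : IsLat P) :
    CliffordD.dual P ≤ CliffordD.dual N ↔ N ≤ P :=
  ⟨fun h => by simpa [hN.dual_dual, hP.dual_dual] using dual_anti h, dual_anti⟩

theorem IsLat.dual_lt {N P : OSub} (hN : IsLat N) (hP : IsLat P) (h : N < P) :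
    CliffordD.dual P < CliffordD.dual N := by
  rw [lt_iff_le_not_ge, hN.dual_le_iff hP, hP.dual_le_iff hN]
  exact lt_iff_le_not_ge.1 h

/-! ### Lattices over the unimodular ring -/

/-- A basis of `N` over `Opi` is also a basis of `E_π³`: independence passes to the fraction field,
and every vector can be scaled into `N`. Its coordinate matrix is the required element of `GL₃`. -/
theorem isLat_of_basis {ι : Type} [Fintype ι] {N : OSub} (b : Module.Basis ι Opi N)
    (hspan : ∀ x : V, ∃ c : Epiˣ, c • x ∈ N) : IsLat N := by
  have hli : LinearIndependent Epi fun i => (b i : V) := by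
    have h1 : LinearIndependent Opi fun i => (b i : V) :=
      b.linearIndependent.map' N.subtype (Submodule.ker_subtype N)
    exact (LinearIndependent.iff_fractionRing Opi Epi).1 h1
  have hsp : ⊤ ≤ Submodule.span Epi (Set.range fun i => (b i : V)) := by
    intro x _
    obtain ⟨c, hc⟩ := hspan x
    have h2 : ((⟨c • x, hc⟩ : N) : V) ∈ Submodule.span Epi (Set.range fun i => (b i : V)) := by
      rw [← b.sum_repr ⟨c • x, hc⟩]
      rw [Submodule.coe_sum]
      refine Submodule.sum_mem _ fun i _ => ?_
      change ((b.repr ⟨c • x, hc⟩ i : Opi) : Epi) • (b i : V) ∈ _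
      exact Submodule.smul_mem _ _ (Submodule.subset_span ⟨i, rfl⟩)
    have h3 := Submodule.smul_mem _ ((c⁻¹ : Epiˣ) : Epi) h2
    change ((c⁻¹ : Epiˣ) : Epi) • (c • x) ∈ _ at h3
    rwa [← Units.smul_def, inv_smul_smul] at h3
  let B := Module.Basis.mk hli hsp
  have hcard : Fintype.card ι = 3 := by
    rw [← Module.finrank_eq_card_basis B]; simp
  let e : ι ≃ Fin 3 := Fintype.equivFinOfCardEq hcard
  let B' := B.reindex e
  let b' := b.reindex e
  have hB' : ∀ i, B' i = (b' i : V) := by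
    intro i
    simp [B', b', B]
  let M : Matrix (Fin 3) (Fin 3) Epi := (Pi.basisFun Epi (Fin 3)).toMatrix B'
  have hM : IsUnit M := by
    have := (Pi.basisFun Epi (Fin 3)).invertibleToMatrix B'
    exact isUnit_of_invertible M
  have hMj : ∀ y : V, M *ᵥ y = ∑ j, y j • (b' j : V) := by
    intro y
    refine funext fun i => ?_
    simp only [Matrix.mulVec, dotProduct, Finset.sum_apply, Pi.smul_apply, smul_eq_mul, M,
      Module.Basis.toMatrix_apply, Pi.basisFun_repr, hB']
    refine Finset.sum_congr rfl fun j _ => ?_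
    rw [mul_comm]
  refine ⟨hM.unit, ?_⟩
  ext x
  constructor
  · rintro hx
    have e : x = M *ᵥ (hM.unit⁻¹.val *ᵥ x) := by
      rw [Matrix.mulVec_mulVec]
      conv_lhs => rw [← Matrix.one_mulVec x, ← Units.val_one, ← mul_inv_cancel hM.unit]
      rfl
    rw [e, hMj]
    exact N.sum_mem fun j _ => N.smul_mem (⟨_, mem_lattice.1 hx j⟩ : Opi) (b' j).2
  · intro hx
    rw [mem_lattice]
    have e : x = M *ᵥ fun j => ((b'.repr ⟨x, hx⟩ j : Opi) : Epi) := by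
      rw [hMj]
      have := congrArg (Submodule.subtype N) (b'.sum_repr ⟨x, hx⟩)
      rw [map_sum] at this
      exact this.symm
    have e2 : hM.unit⁻¹.val *ᵥ x = fun j => ((b'.repr ⟨x, hx⟩ j : Opi) : Epi) := by
      conv_lhs => rw [e]
      rw [Matrix.mulVec_mulVec]
      conv_rhs => rw [← Matrix.one_mulVec fun j => ((b'.repr ⟨x, hx⟩ j : Opi) : Epi),
        ← Units.val_one, ← inv_mul_cancel hM.unit]
      rfl
    intro i
    rw [e2]
    exact (b'.repr ⟨x, hx⟩ i).2

theorem exists_smul_mem_lattice (g : GLpi) (x : V) : ∃ c : Epiˣ, c • x ∈ lattice g := by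
  have h : ∀ y : Epi, ∃ n : ℕ, ∀ m ≥ n, (piUnit : Epi) ^ m * y ∈ Opi := by
    intro y
    by_cases hy : y = 0
    · exact ⟨0, fun m _ => by rw [hy, mul_zero]; exact zero_mem _⟩
    refine ⟨(-ord (Units.mk0 y hy)).toNat, fun m hm => ?_⟩
    have := unit_mem_Opi_iff (piUnit ^ m * Units.mk0 y hy)
    rw [Units.val_mul, Units.val_pow_eq_pow_val, Units.val_mk0] at this
    rw [this, ord_mul, ord_pow, ord_pi]
    have := Int.self_le_toNat (-ord (Units.mk0 y hy))
    have : ((-ord (Units.mk0 y hy)).toNat : ℤ) ≤ m := by exact_mod_cast hm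
    linarith
  choose n hn using h
  refine ⟨piUnit ^ (∑ i, n ((g⁻¹.val *ᵥ x) i)), ?_⟩
  rw [mem_lattice]
  intro i
  rw [Units.smul_def, Matrix.mulVec_smul, Units.val_pow_eq_pow_val]
  exact hn _ _ (Finset.single_le_sum (f := fun i => n ((g⁻¹.val *ᵥ x) i)) (fun _ _ => Nat.zero_le _)
    (Finset.mem_univ i))

theorem lattice_fg (g : GLpi) : (lattice g).FG := by
  rw [lattice]
  refine Submodule.FG.map _ ?_
  exact LinearMap.range_eq_map ((Algebra.linearMap Opi Epi).compLeft (Fin 3)) ▸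
    (Module.Finite.fg_top).map _

/-- A submodule between two lattices is a lattice. -/
theorem IsLat.of_le_of_le {N P Q : OSub} (hP : IsLat P) (hQ : IsLat Q) (h1 : P ≤ N) (h2 : N ≤ Q) :
    IsLat N := by
  obtain ⟨g, rfl⟩ := hP
  obtain ⟨h, rfl⟩ := hQ
  have hfin : Module.Finite Opi (lattice h) := Module.Finite.iff_fg.2 (lattice_fg h)
  have hN : Module.Finite Opi N := by
    have hno : IsNoetherian Opi (lattice h) := inferInstance
    exact Module.Finite.of_injective (Submodule.inclusion h2) (Submodule.inclusion_injective h2)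
  -- Finitely generated and torsion-free over a principal ideal domain.
  have hfree : Module.Free Opi N := inferInstance
  let b := Module.Free.chooseBasis Opi N
  refine isLat_of_basis (b.reindex (Fintype.equivFin _)) fun x => ?_
  obtain ⟨c, hc⟩ := exists_smul_mem_lattice g x
  exact ⟨c, h1 hc⟩

/-! ### Reduction of a lattice modulo `π` -/

/-- The reduction `g O³ → 𝔽₃³`. -/
def redL (g : GLpi) : lattice g →ₛₗ[red] (Fin 3 → ZMod 3) where
  toFun x i := red ⟨(g⁻¹.val *ᵥ (x : V)) i, mem_lattice.1 x.2 i⟩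
  map_add' x y := by
    funext i
    rw [Pi.add_apply, ← map_add]
    congr 1
    apply Subtype.ext
    change (g⁻¹.val *ᵥ ((x : V) + y)) i = _
    rw [Matrix.mulVec_add]
    rfl
  map_smul' c x := by
    funext i
    rw [Pi.smul_apply, smul_eq_mul, ← map_mul]
    congr 1
    apply Subtype.ext
    change (g⁻¹.val *ᵥ ((c : Epi) • (x : V))) i = _
    rw [Matrix.mulVec_smul]
    rfl

theorem redL_eq_zero_iff {g : GLpi} (x : lattice g) : redL g x = 0 ↔ (x : V) ∈ piUnit • lattice g := by
  rw [mem_smul_iff, mem_lattice, funext_iff]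
  refine forall_congr' fun i => ?_
  rw [Units.smul_def, Matrix.mulVec_smul]
  exact red_eq_zero_iff _

theorem unit_smul_mem {N : OSub} {c : Opi} (hc : red c ≠ 0) {x : V} (h : c • x ∈ N) : x ∈ N := by
  obtain ⟨u, rfl⟩ := (isUnit_iff_red_ne_zero c).2 hc
  have := N.smul_mem ((u⁻¹ : Opiˣ) : Opi) h
  rwa [smul_smul, Units.inv_mul, one_smul] at this

/-- In a chain `π C < A < B < C` the last step has length one. -/
theorem eq_sup_span_of_chain {A B C : OSub} (hC : IsLat C) (h1 : piUnit • C < A) (h2 : A < B)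
    (h3 : B < C) {w : V} (hw : w ∈ C) (hwB : w ∉ B) : C = B ⊔ Submodule.span Opi {w} := by
  obtain ⟨g, rfl⟩ := hC
  obtain ⟨b, hb, hbA⟩ := SetLike.exists_of_lt h2
  obtain ⟨a, ha, haC⟩ := SetLike.exists_of_lt h1
  let a' : lattice g := ⟨a, h3.le (h2.le ha)⟩
  let b' : lattice g := ⟨b, h3.le hb⟩
  let w' : lattice g := ⟨w, hw⟩
  have key : ∀ α β γ : Opi, red α • redL g a' + red β • redL g b' + red γ • redL g w' = 0 →
      α • a + β • b + γ • w ∈ piUnit • lattice g := by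
    intro α β γ h
    rw [← LinearMap.map_smulₛₗ, ← LinearMap.map_smulₛₗ, ← LinearMap.map_smulₛₗ, ← map_add,
      ← map_add, redL_eq_zero_iff] at h
    exact h
  -- Here `w ∉ B`, `b ∈ B \ A` and `a ∈ A \ πC`. Testing a relation against `B`, then `A`, then `πC`
  -- kills its coefficients one at a time, so the three reductions form a basis of `C/πC`.
  have hli : LinearIndependent (ZMod 3) ![redL g a', redL g b', redL g w'] := by
    rw [Fintype.linearIndependent_iff]
    intro f hf
    rw [Fin.sum_univ_three] at hf
    obtain ⟨α, hα⟩ := red_surjective (f 0)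
    obtain ⟨β, hβ⟩ := red_surjective (f 1)
    obtain ⟨γ, hγ⟩ := red_surjective (f 2)
    rw [← hα, ← hβ, ← hγ] at hf
    change red α • redL g a' + red β • redL g b' + red γ • redL g w' = 0 at hf
    have g2 : red γ = 0 := by
      by_contra h
      refine hwB (unit_smul_mem h ?_)
      have h4 := h2.le (h1.le (key _ _ _ hf))
      have := B.sub_mem h4 (B.add_mem (B.smul_mem α (h2.le ha)) (B.smul_mem β hb))
      rwa [add_sub_cancel_left] at this
    have g1 : red β = 0 := by
      by_contra h
      refine hbA (unit_smul_mem h ?_)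
      have h4 := h1.le (key α β 0 (by rw [map_zero, ← g2]; exact hf))
      have := A.sub_mem h4 (A.smul_mem α ha)
      rwa [zero_smul, add_zero, add_sub_cancel_left] at this
    have g0 : red α = 0 := by
      by_contra h
      refine haC (unit_smul_mem h ?_)
      have h4 := key α 0 0 (by rw [map_zero]; rw [g1, g2] at hf; exact hf)
      rwa [zero_smul, add_zero, zero_smul, add_zero] at h4
    intro i
    fin_cases i
    · exact hα ▸ g0
    · exact hβ ▸ g1
    · exact hγ ▸ g2
  have hsp := hli.span_eq_top_of_card_eq_finrank (by simp)
  refine le_antisymm ?_ (sup_le h3.le ((Submodule.span_singleton_le_iff_mem _ _).2 hw))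
  intro x hx
  have hxs : redL g ⟨x, hx⟩ ∈ Submodule.span (ZMod 3)
    (Set.range ![redL g a', redL g b', redL g w']) := by rw [hsp]; trivial
  obtain ⟨f, hf⟩ := (Submodule.mem_span_range_iff_exists_fun _).1 hxs
  rw [Fin.sum_univ_three] at hf
  obtain ⟨α, hα⟩ := red_surjective (f 0)
  obtain ⟨β, hβ⟩ := red_surjective (f 1)
  obtain ⟨γ, hγ⟩ := red_surjective (f 2)
  rw [← hα, ← hβ, ← hγ] at hf
  change red α • redL g a' + red β • redL g b' + red γ • redL g w' = _ at hf
  rw [← LinearMap.map_smulₛₗ, ← LinearMap.map_smulₛₗ, ← LinearMap.map_smulₛₗ, ← map_add,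
    ← map_add, ← sub_eq_zero, ← map_sub, redL_eq_zero_iff] at hf
  have h4 : α • a + β • b + γ • w - x ∈ B := h2.le (h1.le hf)
  have h5 : α • a + β • b ∈ B := B.add_mem (B.smul_mem α (h2.le ha)) (B.smul_mem β hb)
  have e : x = (α • a + β • b - (α • a + β • b + γ • w - x)) + γ • w := by abel
  rw [e]
  exact Submodule.add_mem_sup (B.sub_mem h5 h4)
    (Submodule.smul_mem _ _ (Submodule.mem_span_singleton_self w))

/-! ### Self-dual lattices -/

/-- A lattice equal to its dual. -/
def SelfDual (N : OSub) : Prop := IsLat N ∧ dual N = N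

theorem odet_eq_zero_of_selfDual {g : GLpi} (h : dual (lattice g) = lattice g) : odet g = 0 := by
  rw [dual_lattice] at h
  have := odet_eq_of_lattice_eq (g := g) (h := sharp g) (c := 1) (by rw [one_smul, h])
  rw [odet_sharp, ord_one] at this
  linarith

theorem SelfDual.eq_of_smul {N P : OSub} (hN : SelfDual N) (hP : SelfDual P) {c : Epiˣ}
    (h : P = c • N) : P = N := by
  obtain ⟨⟨g, rfl⟩, hg⟩ := hN
  obtain ⟨⟨k, rfl⟩, hk⟩ := hP
  have := odet_eq_of_lattice_eq h
  rw [odet_eq_zero_of_selfDual hg, odet_eq_zero_of_selfDual hk] at this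
  rw [h, smul_eq_of_ord_eq (d := 1) (by rw [ord_one]; linarith), one_smul]

/-- There is no lattice `B` with `dual B = π B`. -/
theorem pi_smul_ne_dual {B : OSub} (hB : IsLat B) : piUnit • B ≠ dual B := by
  obtain ⟨g, rfl⟩ := hB
  intro h
  rw [dual_lattice] at h
  have := odet_eq_of_lattice_eq h.symm
  rw [odet_sharp, ord_pi] at this
  omega

/-- If the dual of `L` is `c L`, comparing determinants gives `3 ord c = -2 odet g`. Hence `ord c =
2m` is even, and `π^m L` is self-dual. -/
theorem exists_selfDual (x : LVertex) : ∃ g : GLpi, (g : BVertex) = x.1 ∧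
    dual (lattice g) = lattice g := by
  obtain ⟨x, hx⟩ := x
  induction x using QuotientGroup.induction_on with
  | H g =>
    rw [sharpB_mk, eq_comm, mk_eq_iff] at hx
    obtain ⟨c, hc⟩ := hx
    have h := odet_eq_of_lattice_eq hc
    rw [odet_sharp] at h
    obtain ⟨m, hm⟩ : ∃ m, ord c = 2 * m := ⟨ord c / 2, by omega⟩
    refine ⟨Matrix.GeneralLinearGroup.scalar (Fin 3) (piUnit ^ m) * g,
      (mk_eq_iff.2 ⟨piUnit ^ m, lattice_scalar_mul _ _⟩).symm, ?_⟩
    rw [lattice_scalar_mul, dual_smul, dual_lattice, hc, smul_smul]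
    apply smul_eq_of_ord_eq
    rw [ord_mul, ord_inv, ord_zpow, ord_pi, hm]
    ring

/-- The self-dual lattice of a vertex fixed by `#`. -/
def latOf (x : LVertex) : OSub := lattice (exists_selfDual x).choose

theorem selfDual_latOf (x : LVertex) : SelfDual (latOf x) :=
  ⟨⟨_, rfl⟩, (exists_selfDual x).choose_spec.2⟩

theorem latOf_spec (x : LVertex) : ∃ g : GLpi, (g : BVertex) = x.1 ∧ lattice g = latOf x :=
  ⟨_, (exists_selfDual x).choose_spec.1, rfl⟩

theorem latOf_eq {x : LVertex} {g : GLpi} (hx : (g : BVertex) = x.1)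
    (hg : dual (lattice g) = lattice g) : latOf x = lattice g := by
  obtain ⟨h, hh, e⟩ := latOf_spec x
  rw [← hx, eq_comm, mk_eq_iff] at hh
  obtain ⟨c, hc⟩ := hh
  rw [← e]
  exact SelfDual.eq_of_smul ⟨⟨g, rfl⟩, hg⟩ (by rw [e]; exact selfDual_latOf x) hc

theorem latOf_injective : Function.Injective latOf := by
  intro x y h
  obtain ⟨g, hg, e⟩ := latOf_spec x
  obtain ⟨k, hk, e'⟩ := latOf_spec y
  apply Subtype.ext
  rw [← hg, ← hk]
  exact mk_eq_of_lattice_eq (by rw [e, e', h])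

theorem exists_latOf_eq {N : OSub} (hN : SelfDual N) : ∃ x, latOf x = N := by
  obtain ⟨⟨g, rfl⟩, hg⟩ := hN
  refine ⟨⟨(g : BVertex), ?_⟩, latOf_eq rfl hg⟩
  rw [sharpB_mk]
  exact mk_eq_of_lattice_eq (by rw [← dual_lattice, hg])

/-! ### Counting neighbours -/

/-- When an intermediate lattice exists, `B/M` is a plane over the field with three elements with
basis `u, v`; its lines are spanned by `u`, `v`, `u + v` and `u - v`. Without one, any constant
family serves. -/
theorem exists_four_between {M B : OSub} (hM : IsLat M) (hB : IsLat B) (h1 : piUnit • B < M) :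
    ∃ f : Fin 4 → OSub, ∀ L, M < L → L < B → ∃ i, L = f i := by
  by_cases hne : ∃ L, M < L ∧ L < B
  swap
  · exact ⟨fun _ => M, fun L h2 h3 => absurd ⟨L, h2, h3⟩ hne⟩
  have step : ∀ L, M < L → L < B → ∀ w ∈ L, w ∉ M → L = M ⊔ Submodule.span Opi {w} := by
    intro L h2 h3 w hw hwM
    exact eq_sup_span_of_chain (hM.of_le_of_le hB h2.le h3.le) (smul_lt_smul_iff.2 h3) h1 h2 hw hwM
  obtain ⟨L₀, h2, h3⟩ := hne
  obtain ⟨u, hu, huM⟩ := SetLike.exists_of_lt h2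
  obtain ⟨v, hv, hvL⟩ := SetLike.exists_of_lt h3
  have e1 := step L₀ h2 h3 u hu huM
  have e2 := eq_sup_span_of_chain hB h1 h2 h3 hv hvL
  refine ⟨fun i => M ⊔ Submodule.span Opi {![u, v, u + v, u - v] i}, fun L h4 h5 => ?_⟩
  obtain ⟨w, hw, hwM⟩ := SetLike.exists_of_lt h4
  have hwB := h5.le hw
  rw [e2, e1] at hwB
  obtain ⟨y, hy, z, hz, rfl⟩ := Submodule.mem_sup.1 hwB
  obtain ⟨m, hm, t, ht, rfl⟩ := Submodule.mem_sup.1 hy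
  obtain ⟨b, rfl⟩ := Submodule.mem_span_singleton.1 hz
  obtain ⟨a, rfl⟩ := Submodule.mem_span_singleton.1 ht
  have hw2 : a • u + b • v ∈ L := by
    have := L.sub_mem hw (h4.le hm)
    rwa [add_assoc, add_sub_cancel_left] at this
  have hw2M : a • u + b • v ∉ M := fun h => hwM (by rw [add_assoc]; exact M.add_mem hm h)
  have red0 : ∀ (c : Opi) (x : V), x ∈ B → red c = 0 → c • x ∈ M := by
    intro c x hx hc
    refine h1.le (mem_smul_iff.2 ?_)
    rw [red_eq_zero_iff] at hc
    have := B.smul_mem (⟨_, hc⟩ : Opi) hx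
    convert this using 1
    change piUnit⁻¹ • ((c : Epi) • x) = (((piUnit⁻¹ : Epiˣ) : Epi) * c) • x
    rw [mul_smul]
    rfl
  have huB := h3.le hu
  have congr : ∀ (n m : ℤ), red a = n → red b = m → n • u + m • v ∈ L ∧ n • u + m • v ∉ M := by
    intro n m hn hm'
    have hd : (a • u + b • v) - (n • u + m • v) ∈ M := by
      have e : (a • u + b • v) - (n • u + m • v) =
          (a - (n : Opi)) • u + (b - (m : Opi)) • v := by
        rw [sub_smul, sub_smul, Int.cast_smul_eq_zsmul, Int.cast_smul_eq_zsmul]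
        abel
      rw [e]
      exact M.add_mem (red0 _ _ huB (by rw [map_sub, hn, map_intCast, sub_self]))
        (red0 _ _ hv (by rw [map_sub, hm', map_intCast, sub_self]))
    constructor
    · have := L.sub_mem hw2 (h4.le hd)
      rwa [sub_sub_cancel] at this
    · intro h
      have := M.add_mem hd h
      rw [sub_add_cancel] at this
      exact hw2M this
  have tri : ∀ z : ZMod 3, z = ((0 : ℤ) : ZMod 3) ∨ z = ((1 : ℤ) : ZMod 3) ∨
    z = ((-1 : ℤ) : ZMod 3) := by decide
  have fin : ∀ i, (![u, v, u + v, u - v] i ∈ L ∧ ![u, v, u + v, u - v] i ∉ M) ∨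
      (-![u, v, u + v, u - v] i ∈ L ∧ -![u, v, u + v, u - v] i ∉ M) →
      ∃ i, L = M ⊔ Submodule.span Opi {![u, v, u + v, u - v] i} := by
    intro i hi
    refine ⟨i, step L h4 h5 _ ?_ ?_⟩
    · rcases hi with hi | hi
      · exact hi.1
      · exact L.neg_mem_iff.1 hi.1
    · rcases hi with hi | hi
      · exact hi.2
      · exact fun h => hi.2 (M.neg_mem h)
  rcases tri (red a) with ha | ha | ha <;> rcases tri (red b) with hb | hb | hb <;>
    have hab := congr _ _ ha hb
  · exact absurd M.zero_mem (by simpa using hab.2)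
  · exact fin 1 (Or.inl (by simpa using hab))
  · exact fin 1 (Or.inr (by simpa using hab))
  · exact fin 0 (Or.inl (by simpa using hab))
  · exact fin 2 (Or.inl (by simpa using hab))
  · exact fin 3 (Or.inl (by simpa [sub_eq_add_neg] using hab))
  · exact fin 0 (Or.inr (by simpa using hab))
  · exact fin 3 (Or.inr (by simpa [sub_eq_add_neg, add_comm] using hab))
  · exact fin 2 (Or.inr (by simpa [add_comm] using hab))

/-- Representatives of the points of the projective plane over `𝔽₃`. -/
def projPoints : Finset (ZMod 3 × ZMod 3 × ZMod 3) :=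
  {(1,0,0),(0,1,0),(0,0,1),(1,1,0),(1,2,0),(1,0,1),(1,0,2),(0,1,1),(0,1,2),(1,1,1),(1,1,2),(1,2,1),(1,2,2)}

theorem mem_projPoints_or_neg : ∀ x y z : ZMod 3, (x, y, z) ≠ 0 →
    (x, y, z) ∈ projPoints ∨ (-x, -y, -z) ∈ projPoints := by decide +kernel

/-- A smooth conic over a field of three elements has four points. The hypothesis is that the
symmetric matrix with rows `(a,b,c)`, `(b,d,e)`, `(c,e,f)` has nonzero determinant, and all forms
are enumerated. -/
theorem card_conic_le : ∀ a b c d e f : ZMod 3,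
    a * (d * f - e * e) - b * (b * f - e * c) + c * (b * e - d * c) ≠ 0 →
    (projPoints.filter fun p => a * (p.1 * p.1) + d * (p.2.1 * p.2.1) + f * (p.2.2 * p.2.2) +
      2 * (b * (p.1 * p.2.1) + c * (p.1 * p.2.2) + e * (p.2.1 * p.2.2)) = 0).card ≤ 4 := by
  decide +kernel

/-- The Gram matrix is `g^* g`. Self-duality says that it is integral with integral inverse, which
makes the reduced form nondegenerate. -/
theorem SelfDual.exists_gram {g : GLpi} (h : dual (lattice g) = lattice g) :
    ∃ k : GL (Fin 3) Opi, (∀ i j, conjOpi (k.val i j) = k.val j i) ∧ ∀ x y : Fin 3 → Opi,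
      hf (g.val *ᵥ fun i => (x i : Epi)) (g.val *ᵥ fun i => (y i : Epi)) =
        ∑ i, ∑ j, ((conjOpi (x i) * k.val i j * y j : Opi) : Epi) := by
  rw [dual_lattice, lattice_eq_iff] at h
  obtain ⟨k, hk⟩ := h
  have e : g.valᴴ * g.val = k.val.map Opi.subtype := by
    have h2 : (star g) * g = Matrix.GeneralLinearGroup.map Opi.subtype k := by
      have h3 := congrArg (star g * ·) hk
      change star g * g = star g * ((star g)⁻¹ * _) at h3
      rwa [mul_inv_cancel_left] at h3
    exact congrArg Units.val h2
  refine ⟨k, fun i j => Subtype.ext ?_, fun x y => ?_⟩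
  · have h2 : star ((g.valᴴ * g.val) i j) = (g.valᴴ * g.val) j i := by
      rw [← Matrix.conjTranspose_apply, Matrix.conjTranspose_mul, Matrix.conjTranspose_conjTranspose]
    rw [e] at h2
    exact h2
  rw [hf_mulVec, Matrix.mulVec_mulVec, e, hf]
  simp only [dotProduct, Matrix.mulVec, Matrix.map_apply, Finset.mul_sum, mul_assoc]
  rfl

theorem finite_between {M B : OSub} (hM : IsLat M) (hB : IsLat B) (h1 : piUnit • B < M) :
    {L | M < L ∧ L < B}.Finite ∧ {L | M < L ∧ L < B}.ncard ≤ 4 := by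
  obtain ⟨f, hf⟩ := exists_four_between hM hB h1
  have hsub : {L | M < L ∧ L < B} ⊆ Set.range f := by
    rintro L ⟨h2, h3⟩
    obtain ⟨i, rfl⟩ := hf L h2 h3
    exact ⟨i, rfl⟩
  refine ⟨(Set.finite_range f).subset hsub, (Set.ncard_le_ncard hsub (Set.finite_range f)).trans ?_⟩
  rw [← Set.image_univ]
  exact (Set.ncard_image_le).trans (by simp)

/-- The lattices `M` with `π M^# < M < L` for a self-dual lattice `L`. -/
def belowSet (L : OSub) : Set OSub := {M | IsLat M ∧ piUnit • dual M < M ∧ M < L}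

/-- The last step of the chain `π M^# < M < L < M^#` has length one. So `M` can be recovered from
`L` and any vector of `π M^#` outside `πL`. -/
theorem dual_eq_of_mem_belowSet {L M : OSub} (hL : SelfDual L) (hM : M ∈ belowSet L) {w : V}
    (hw : w ∈ piUnit • dual M) (hwL : w ∉ piUnit • L) :
    dual M = L ⊔ Submodule.span Opi {piUnit⁻¹ • w} := by
  obtain ⟨h1, h2, h3⟩ := hM
  have h4 : L < dual M := by
    have := h1.dual_lt hL.1 h3
    rwa [hL.2] at this
  exact eq_sup_span_of_chain h1.dual h2 h3 h4 (mem_smul_iff.1 hw) fun h => hwL (mem_smul_iff.2 h)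

/-- To `M` corresponds the line `π M^# / πL` in `L/πL`. It is isotropic for the reduced form and
determines `M`, so the bound is the number of points of a smooth conic. -/
theorem finite_belowSet {L : OSub} (hL : SelfDual L) :
    (belowSet L).Finite ∧ (belowSet L).ncard ≤ 4 := by
  obtain ⟨⟨g, rfl⟩, hg⟩ := hL
  obtain ⟨k, hk, hform⟩ := SelfDual.exists_gram hg
  let a := red (k.val 0 0)
  let b := red (k.val 0 1)
  let c := red (k.val 0 2)
  let d := red (k.val 1 1)
  let e := red (k.val 1 2)
  let f := red (k.val 2 2)
  have sym : ∀ i j, red (k.val i j) = red (k.val j i) := by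
    intro i j
    rw [← hk, red_conjOpi]
  have hdet : a * (d * f - e * e) - b * (b * f - e * c) + c * (b * e - d * c) ≠ 0 := by
    have h1 : red k.val.det ≠ 0 := ((Matrix.isUnit_iff_isUnit_det _).1 k.isUnit |>.map red).ne_zero
    rw [Matrix.det_fin_three] at h1
    simp only [map_add, map_sub, map_mul] at h1
    rw [sym 1 0, sym 2 0, sym 2 1] at h1
    contrapose! h1
    rw [← h1]
    ring
  let T := projPoints.filter fun p => a * (p.1 * p.1) + d * (p.2.1 * p.2.1) + f * (p.2.2 * p.2.2) +
      2 * (b * (p.1 * p.2.1) + c * (p.1 * p.2.2) + e * (p.2.1 * p.2.2)) = 0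
  have hT : T.card ≤ 4 := card_conic_le a b c d e f hdet
  have key : ∀ M ∈ belowSet (lattice g), ∃ p ∈ T, ∃ w : lattice g, (w : V) ∈ piUnit • dual M ∧
      redL g w = ![p.1, p.2.1, p.2.2] := by
    intro M hM
    obtain ⟨h1, h2, h3⟩ := hM
    have h4 : lattice g < dual M := by
      have := h1.dual_lt ⟨g, rfl⟩ h3
      rwa [hg] at this
    obtain ⟨w, hw, hwL⟩ := SetLike.exists_of_lt (smul_lt_smul_iff (c := piUnit).2 h4)
    let w' : lattice g := ⟨w, h3.le (h2.le hw)⟩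
    have hiso : ∀ w : lattice g, (w : V) ∈ piUnit • dual M → a * (redL g w 0 * redL g w 0) +
        d * (redL g w 1 * redL g w 1) + f * (redL g w 2 * redL g w 2) +
        2 * (b * (redL g w 0 * redL g w 1) + c * (redL g w 0 * redL g w 2) +
        e * (redL g w 1 * redL g w 2)) = 0 := by
      intro w hw
      -- The vector `w` lies both in `π M^#` and in `M`, so its pairing with itself is divisible by
      -- `π`: the reduced vector is isotropic.
      have h5 := mem_smul_iff.1 hw w (h2.le hw)
      rw [Units.smul_def, hf_smul_right] at h5
      let x : Fin 3 → Opi := fun i => ⟨(g⁻¹.val *ᵥ (w : V)) i, mem_lattice.1 w.2 i⟩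
      have hx : g.val *ᵥ (fun i => (x i : Epi)) = w := by
        change g.val *ᵥ (g⁻¹.val *ᵥ (w : V)) = w
        rw [Matrix.mulVec_mulVec, ← Units.val_mul, mul_inv_cancel, Units.val_one,
          Matrix.one_mulVec]
      have h6 := hform x x
      rw [hx] at h6
      have h7 : hf (w : V) w = ((∑ i, ∑ j, conjOpi (x i) * k.val i j * x j : Opi) : Epi) := by
        rw [h6]
        push_cast
        rfl
      rw [h7, ← red_eq_zero_iff] at h5
      simp only [Fin.sum_univ_three, map_add, map_mul, red_conjOpi] at h5
      rw [sym 1 0, sym 2 0, sym 2 1] at h5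
      rw [← h5]
      change a * (red (x 0) * red (x 0)) + d * (red (x 1) * red (x 1)) +
        f * (red (x 2) * red (x 2)) + 2 * (b * (red (x 0) * red (x 1)) +
        c * (red (x 0) * red (x 2)) + e * (red (x 1) * red (x 2))) = _
      ring
    have hne : (redL g w' 0, redL g w' 1, redL g w' 2) ≠ 0 := by
      intro h
      refine hwL ((redL_eq_zero_iff w').1 ?_)
      simp only [Prod.mk_eq_zero] at h
      funext i
      fin_cases i
      exacts [h.1, h.2.1, h.2.2]
    rcases mem_projPoints_or_neg _ _ _ hne with h | h
    · refine ⟨_, Finset.mem_filter.2 ⟨h, hiso w' hw⟩, w', hw, ?_⟩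
      funext i
      fin_cases i <;> rfl
    · have hn : ((-w' : lattice g) : V) ∈ piUnit • dual M := (piUnit • dual M).neg_mem hw
      have h8 := hiso (-w') hn
      rw [map_neg] at h8
      refine ⟨_, Finset.mem_filter.2 ⟨h, h8⟩, -w', hn, ?_⟩
      rw [map_neg]
      funext i
      fin_cases i <;> rfl
  choose! p hpT w hw hp using key
  have hinj : Set.InjOn p (belowSet (lattice g)) := by
    intro M hM M' hM' hpp
    have h9 : ∀ M ∈ belowSet (lattice g), (w M : V) ∉ piUnit • lattice g := by
      intro M hM h
      rw [← redL_eq_zero_iff, hp M hM] at h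
      have h10 := (Finset.mem_filter.1 (hpT M hM)).1
      have h11 : p M = 0 := Prod.ext (congrFun h 0) (Prod.ext (congrFun h 1) (congrFun h 2))
      rw [h11] at h10
      exact absurd h10 (by decide)
    -- Equal projective points give vectors congruent modulo `πL`, and `πL ≤ π M'^#`. Hence one
    -- vector serves for both lattices.
    have h12 : (w M : V) ∈ piUnit • dual M' := by
      have h13 : redL g (w M - w M') = 0 := by
        rw [map_sub, hp M hM, hp M' hM', hpp, sub_self]
      rw [redL_eq_zero_iff] at h13
      have h14 : lattice g ≤ dual M' := by
        have := dual_anti hM'.2.2.le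
        rwa [hg] at this
      have := (piUnit • dual M').add_mem (smul_le_smul_iff.2 h14 h13) (hw M' hM')
      simpa using this
    have h15 := dual_eq_of_mem_belowSet ⟨⟨g, rfl⟩, hg⟩ hM (hw M hM) (h9 M hM)
    rw [← dual_eq_of_mem_belowSet ⟨⟨g, rfl⟩, hg⟩ hM' h12 (h9 M hM)] at h15
    rw [← hM.1.dual_dual, h15, hM'.1.dual_dual]
  constructor
  · exact Set.Finite.of_injOn (t := (T : Set _)) (fun M hM => hpT M hM) hinj T.finite_toSet
  · refine (Set.ncard_le_ncard_of_injOn p (fun M hM => hpT M hM) hinj T.finite_toSet).trans ?_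
    rwa [Set.ncard_coe_finset]

/-! ## The tree in terms of lattices -/

theorem isChain_rotate {x y z : BVertex} (h : IsChain x y z) : IsChain z x y := by
  obtain ⟨a, b, c, rfl, rfl, rfl, h1, h2, h3⟩ := h
  refine ⟨Matrix.GeneralLinearGroup.scalar (Fin 3) piUnit * c, a, b,
    (mk_eq_iff.2 ⟨piUnit, lattice_scalar_mul _ _⟩).symm, rfl, rfl, ?_, h1, h2⟩
  rw [lattice_scalar_mul, lattice_scalar_mul, smul_lt_smul_iff]
  exact h3

/-- Chains may be rotated cyclically, so `x` can always be moved to the middle; only the order of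
`y` and `z` remains open. -/
theorem exists_isChain_of_isTriangle {x y z : BVertex} (h : IsTriangle x y z) :
    IsChain y x z ∨ IsChain z x y := by
  obtain ⟨σ, h⟩ := h
  have key : ∀ σ : Equiv.Perm (Fin 3), (σ 0 = 0 ∧ σ 1 = 1 ∧ σ 2 = 2) ∨
      (σ 0 = 0 ∧ σ 1 = 2 ∧ σ 2 = 1) ∨ (σ 0 = 1 ∧ σ 1 = 0 ∧ σ 2 = 2) ∨
      (σ 0 = 1 ∧ σ 1 = 2 ∧ σ 2 = 0) ∨ (σ 0 = 2 ∧ σ 1 = 0 ∧ σ 2 = 1) ∨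
      (σ 0 = 2 ∧ σ 1 = 1 ∧ σ 2 = 0) := by decide
  rcases key σ with ⟨h0, h1, h2⟩ | ⟨h0, h1, h2⟩ | ⟨h0, h1, h2⟩ | ⟨h0, h1, h2⟩ | ⟨h0, h1, h2⟩ |
    ⟨h0, h1, h2⟩ <;> rw [h0, h1, h2] at h
  · exact Or.inr (isChain_rotate h)
  · exact Or.inl (isChain_rotate h)
  · exact Or.inl h
  · exact Or.inr (isChain_rotate (isChain_rotate h))
  · exact Or.inr h
  · exact Or.inl (isChain_rotate (isChain_rotate h))

/-- `M` is the normalized lattice representing the reflected edge `e`. -/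
def Rep (e : RVertex) (M : OSub) : Prop :=
  ∃ g : GLpi, lattice g = M ∧ e.1 = s((g : BVertex), ((sharp g : GLpi) : BVertex)) ∧
    piUnit • dual M < M ∧ M < dual M

theorem Rep.isLat {e : RVertex} {M : OSub} (h : Rep e M) : IsLat M := ⟨_, h.choose_spec.1⟩

theorem Rep.pi_smul_dual_lt {e : RVertex} {M : OSub} (h : Rep e M) : piUnit • dual M < M :=
  h.choose_spec.2.2.1

theorem Rep.edge_injective {e e' : RVertex} {M : OSub} (h : Rep e M) (h' : Rep e' M) : e = e' := by
  obtain ⟨g, hg, he, -, -⟩ := h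
  obtain ⟨k, hk, hke, -, -⟩ := h'
  apply Subtype.ext
  rw [he, hke, mk_eq_of_lattice_eq (g := g) (h := k) (by rw [hg, hk]),
    mk_eq_of_lattice_eq (g := sharp g) (h := sharp k) (by
      rw [← dual_lattice, ← dual_lattice, hg, hk])]

/-- Another representative is `t M` or `t M^#`. The inequalities `π M^# < M < M^#` leave room for no
rescaling with `ord t ≠ 0` in the first case and for no `t` at all in the second: each would give a
strict cycle of inclusions. -/
theorem Rep.unique {e : RVertex} {M N : OSub} (h : Rep e M) (h' : Rep e N) : M = N := by
  have hM := h.isLat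
  have hN := h'.isLat
  obtain ⟨g, rfl, he, h1, h2⟩ := h
  obtain ⟨k, rfl, hke, h3, h4⟩ := h'
  rw [he, Sym2.eq_iff] at hke
  rcases hke with ⟨hgk, -⟩ | ⟨-, hgk⟩
  · obtain ⟨t, ht⟩ := mk_eq_iff.1 hgk
    rw [ht, dual_smul, smul_smul] at h3
    rw [ht, dual_smul] at h4
    have hn : ord t = 0 := by
      by_contra hn
      rcases lt_or_gt_of_ne hn with hn | hn
      · have a1 : t⁻¹ • dual (lattice g) ≤ piUnit • dual (lattice g) :=
          smul_le_smul_of_ord_le (by rw [ord_pi, ord_inv]; omega) _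
        have a2 : (1 : Epiˣ) • lattice g ≤ t • lattice g :=
          smul_le_smul_of_ord_le (by rw [ord_one]; omega) _
        rw [one_smul] at a2
        exact absurd ((h4.trans_le a1).trans (h1.trans_le a2)) (lt_irrefl _)
      · have a1 : (1 : Epiˣ) • dual (lattice g) ≤ (piUnit * t⁻¹) • dual (lattice g) :=
          smul_le_smul_of_ord_le (by rw [ord_mul, ord_pi, ord_inv, ord_one]; omega) _
        have a2 : t • lattice g ≤ (1 : Epiˣ) • lattice g :=
          smul_le_smul_of_ord_le (by rw [ord_one]; omega) _
        rw [one_smul] at a1 a2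
        exact absurd ((a1.trans_lt h3).trans_le (a2.trans h2.le)) (lt_irrefl _)
    rw [ht, smul_eq_of_ord_eq (d := 1) (by rw [hn, ord_one]), one_smul]
  · exfalso
    rw [eq_comm, mk_eq_iff] at hgk
    obtain ⟨t, ht⟩ := mk_eq_iff.1 (show ((sharp g : GLpi) : BVertex) = k from
      (mk_eq_iff.2 hgk).symm)
    rw [← dual_lattice] at ht
    rw [ht, dual_smul, smul_smul, hM.dual_dual] at h3
    rw [ht, dual_smul, hM.dual_dual] at h4
    rcases le_or_gt (ord t) 0 with hn | hn
    · have a1 : t⁻¹ • lattice g ≤ (1 : Epiˣ) • lattice g :=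
        smul_le_smul_of_ord_le (by rw [ord_inv, ord_one]; omega) _
      have a2 : (1 : Epiˣ) • dual (lattice g) ≤ t • dual (lattice g) :=
        smul_le_smul_of_ord_le (by rw [ord_one]; omega) _
      rw [one_smul] at a1 a2
      exact absurd ((h4.trans_le a1).trans (h2.trans_le a2)) (lt_irrefl _)
    · have a1 : t • dual (lattice g) ≤ piUnit • dual (lattice g) :=
        smul_le_smul_of_ord_le (by rw [ord_pi]; omega) _
      have a2 : (1 : Epiˣ) • lattice g ≤ (piUnit * t⁻¹) • lattice g :=
        smul_le_smul_of_ord_le (by rw [ord_mul, ord_pi, ord_inv, ord_one]; omega) _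
      rw [one_smul] at a2
      exact absurd ((h3.trans_le a1).trans (h1.trans_le a2)) (lt_irrefl _)

/-- Put the fixed vertex in the middle of the chain and rescale all lattices so that the middle one
is self-dual. The outer two are then dual to each other up to a scalar, which the chain forces to be
a unit. -/
theorem Incident.exists_rep {x : LVertex} {e : RVertex} (h : Incident x e) :
    ∃ M, Rep e M ∧ M < latOf x ∧ latOf x < dual M := by
  obtain ⟨y, z, he, ht⟩ := h
  obtain ⟨y, z, he, hc⟩ : ∃ y z, e.1 = s(y, z) ∧ IsChain y x.1 z := by
    rcases exists_isChain_of_isTriangle ht with h | h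
    · exact ⟨y, z, he, h⟩
    · exact ⟨z, y, he.trans Sym2.eq_swap, h⟩
  have hsharp : sharpB y = z := by
    obtain ⟨y', z', he', -, h1, h2⟩ := e.2
    rw [he, Sym2.eq_iff] at he'
    rcases he' with ⟨rfl, rfl⟩ | ⟨rfl, rfl⟩
    · exact h1
    · exact h2
  obtain ⟨a, b, d, rfl, hb, rfl, h1, h2, h3⟩ := hc
  obtain ⟨b', hb', hx⟩ := latOf_spec x
  rw [← hb', mk_eq_iff] at hb
  obtain ⟨c, hc⟩ := hb
  rw [hx] at hc
  have hself := selfDual_latOf x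
  rw [sharpB_mk, mk_eq_iff] at hsharp
  obtain ⟨t, ht⟩ := hsharp
  rw [← dual_lattice] at ht
  rw [lattice_scalar_mul] at h1
  have hA : IsLat (c • lattice a) := IsLat.smul ⟨a, rfl⟩ c
  have hB : IsLat (c • lattice d) := IsLat.smul ⟨d, rfl⟩ c
  have k1 : piUnit • c • lattice d < c • lattice a := by
    rw [smul_comm, smul_lt_smul_iff]; exact h1
  have k2 : c • lattice a < latOf x := by rw [hc, smul_lt_smul_iff]; exact h2
  have k3 : latOf x < c • lattice d := by rw [hc, smul_lt_smul_iff]; exact h3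
  have hBA : c • lattice d = (c * t * c) • dual (c • lattice a) := by
    rw [dual_smul, ht, smul_smul, smul_smul, mul_inv_cancel_right]
  generalize c * t * c = s at hBA
  have hAB : dual (c • lattice a) = s⁻¹ • c • lattice d := by rw [hBA, inv_smul_smul]
  have l1 : latOf x < s⁻¹ • c • lattice d := by
    have := hA.dual_lt hself.1 k2
    rwa [hself.2, hAB] at this
  have l2 : s⁻¹ • c • lattice a < latOf x := by
    have := hself.1.dual_lt hB k3
    rwa [hself.2, hBA, dual_smul, hA.dual_dual] at this
  -- If `ord s < 0`, the dual of the lower lattice would lie inside `π` times the upper one, hence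
  -- inside `latOf x`; if `ord s > 0`, the upper lattice would lie inside `latOf x`. Both are
  -- impossible.
  have hs : ord s = 0 := by
    by_contra hn
    rcases lt_or_gt_of_ne hn with hn | hn
    · have a1 : s⁻¹ • c • lattice d ≤ piUnit • c • lattice d :=
        smul_le_smul_of_ord_le (by rw [ord_pi, ord_inv]; omega) _
      exact absurd ((l1.trans_le a1).trans (k1.trans k2)) (lt_irrefl _)
    · have a1 : piUnit⁻¹ • c • lattice a ≤ s⁻¹ • c • lattice a :=
        smul_le_smul_of_ord_le (by rw [ord_inv, ord_inv, ord_pi]; omega) _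
      have a2 : c • lattice d < piUnit⁻¹ • c • lattice a := by
        rw [← smul_lt_smul_iff (c := piUnit), smul_inv_smul]; exact k1
      exact absurd ((k3.trans a2).trans_le (a1.trans l2.le)) (lt_irrefl _)
  rw [smul_eq_of_ord_eq (c := s) (d := 1) (by rw [hs, ord_one]), one_smul] at hBA
  refine ⟨c • lattice a, ⟨Matrix.GeneralLinearGroup.scalar (Fin 3) c * a, lattice_scalar_mul c a,
    ?_, hBA ▸ k1, k2.trans (hBA ▸ k3)⟩, k2, hBA ▸ k3⟩
  rw [he]
  have q1 : (a : BVertex) = (Matrix.GeneralLinearGroup.scalar (Fin 3) c * a : GLpi) :=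
    mk_eq_iff.2 ⟨c, lattice_scalar_mul _ _⟩
  have q2 : (d : BVertex) = (sharp (Matrix.GeneralLinearGroup.scalar (Fin 3) c * a) : GLpi) :=
    mk_eq_iff.2 ⟨c, by rw [← dual_lattice, lattice_scalar_mul, ← hBA]⟩
  rw [q1, q2]

theorem isChain_of_lt {M : OSub} {x : LVertex} {g : GLpi} (hg : lattice g = M)
    (h1 : piUnit • dual M < M) (h2 : M < latOf x) (h3 : latOf x < dual M) :
    IsChain g x.1 (sharp g : GLpi) := by
  obtain ⟨b, hb, hx⟩ := latOf_spec x
  refine ⟨g, b, sharp g, rfl, hb, rfl, ?_, ?_, ?_⟩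
  · rwa [lattice_scalar_mul, ← dual_lattice, hg]
  · rwa [hg, hx]
  · rwa [← dual_lattice, hg, hx]

theorem exists_rep_incident {M : OSub} (hM : IsLat M) (h1 : piUnit • dual M < M) {x : LVertex}
    (h2 : M < latOf x) (h3 : latOf x < dual M) :
    ∃ e, Rep e M ∧ Incident x e := by
  obtain ⟨g, hg⟩ := hM
  have hc := isChain_of_lt hg h1 h2 h3
  have hed : IsEdge (g : BVertex) (sharp g : GLpi) := ⟨x.1, Equiv.swap 1 2, hc⟩
  refine ⟨⟨s((g : BVertex), ((sharp g : GLpi) : BVertex)), g, (sharp g : GLpi), rfl, hed, sharpB_mk g,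
    by rw [sharpB_mk, sharp_sharp]⟩, ⟨g, hg, rfl, h1, h2.trans h3⟩, _, _, rfl, Equiv.swap 0 1, hc⟩

theorem Rep.incident {e : RVertex} {M : OSub} (h : Rep e M) {x : LVertex}
    (h2 : M < latOf x) (h3 : latOf x < dual M) : Incident x e := by
  obtain ⟨e', he', hi⟩ := exists_rep_incident h.isLat h.pi_smul_dual_lt h2 h3
  rwa [h.edge_injective he']

/-! ### Valencies and distances in the tree -/

theorem pi_smul_latOf_le {x y : LVertex} {e : RVertex} (hx : Incident x e) (hy : Incident y e) :
    piUnit • latOf y ≤ latOf x := by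
  obtain ⟨M, hM, h1, -⟩ := hx.exists_rep
  obtain ⟨N, hN, -, h2⟩ := hy.exists_rep
  obtain rfl := hM.unique hN
  exact (smul_le_smul_iff.2 h2.le).trans (hM.pi_smul_dual_lt.le.trans h1.le)

/-- Around a lattice vertex, edges embed into `belowSet`; around an edge with representative `M`,
lattice vertices embed into the lattices strictly between `M` and `M^#`. Only the bound by four is
needed. -/
theorem neighborSet_finite (v : Vertex) :
    (tree.neighborSet v).Finite ∧ (tree.neighborSet v).ncard ≤ 4 := by
  classical
  rcases v with x | e
  · have key : ∀ u ∈ tree.neighborSet (.inl x), ∃ M ∈ belowSet (latOf x), ∃ e,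
        u = .inr e ∧ Rep e M := by
      rintro (u | e) hu
      · exact hu.elim
      · obtain ⟨M, hM, h1, -⟩ := Incident.exists_rep hu
        exact ⟨M, ⟨hM.isLat, hM.pi_smul_dual_lt, h1⟩, e, rfl, hM⟩
    choose! f hf e he hr using key
    have hinj : Set.InjOn f (tree.neighborSet (.inl x)) := by
      intro u hu v hv huv
      rw [he u hu, he v hv]
      have h1 := hr u hu
      rw [huv] at h1
      rw [h1.edge_injective (hr v hv)]
    have hfin := finite_belowSet (selfDual_latOf x)
    exact ⟨Set.Finite.of_injOn (fun u hu => hf u hu) hinj hfin.1,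
      (Set.ncard_le_ncard_of_injOn f (fun u hu => hf u hu) hinj hfin.1).trans hfin.2⟩
  · by_cases hne : (tree.neighborSet (.inr e)).Nonempty
    swap
    · rw [Set.not_nonempty_iff_eq_empty.1 hne]
      simp
    obtain ⟨x₀ | u, hx₀⟩ := hne
    swap
    · exact hx₀.elim
    obtain ⟨M, hM, -, -⟩ := Incident.exists_rep (x := x₀) (e := e) hx₀
    have key : ∀ u ∈ tree.neighborSet (.inr e), ∃ L ∈ {L | M < L ∧ L < dual M}, ∃ x,
        u = .inl x ∧ latOf x = L := by
      rintro (x | u) hu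
      · obtain ⟨N, hN, h1, h2⟩ := Incident.exists_rep (x := x) (e := e) hu
        obtain rfl := hM.unique hN
        exact ⟨_, ⟨h1, h2⟩, x, rfl, rfl⟩
      · exact hu.elim
    choose! f hf x hx hl using key
    have hinj : Set.InjOn f (tree.neighborSet (.inr e)) := by
      intro u hu v hv huv
      rw [hx u hu, hx v hv]
      exact congrArg _ (latOf_injective (by rw [hl u hu, hl v hv, huv]))
    have hfin := finite_between hM.isLat hM.isLat.dual hM.pi_smul_dual_lt
    exact ⟨Set.Finite.of_injOn (fun u hu => hf u hu) hinj hfin.1,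
      (Set.ncard_le_ncard_of_injOn f (fun u hu => hf u hu) hinj hfin.1).trans hfin.2⟩

/-- The graph is bipartite, so the walk splits into double steps through reflected edges, each of
which costs one factor `π`. -/
theorem walk_lipschitz (n : ℕ) : ∀ {x y : LVertex} (p : tree.Walk (.inl x) (.inl y)),
    p.length = n → ∃ k, n = 2 * k ∧ piUnit ^ k • latOf y ≤ latOf x := by
  induction n using Nat.strong_induction_on with
  | _ n ih =>
    intro x y p hp
    match p, hp with
    | .nil, hp => exact ⟨0, by simpa using hp.symm, by simp⟩
    | .cons (v := .inl u) h _, _ => exact h.elim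
    | .cons (v := .inr e) h (.cons (v := .inr _) h' _), _ => exact h'.elim
    | .cons (v := .inr e) h (.cons (v := .inl z) h' q), hp =>
      simp only [SimpleGraph.Walk.length_cons] at hp
      obtain ⟨k, hk, hl⟩ := ih q.length (by omega) q rfl
      refine ⟨k + 1, by omega, ?_⟩
      have h1 := pi_smul_latOf_le (x := x) (y := z) (e := e) h h'
      rw [pow_succ', mul_smul]
      exact (smul_le_smul_iff.2 hl).trans h1

/-- With `P = π^k L'` not contained in `L`, set `B = L + P`, so that `B^# = L ∩ P^#`. The lattice
`L₁ = B^# + P` is self-dual, contains `P`, and shares with `L` the edge represented by `B^#`. One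
double step thus lowers `k` by one. -/
theorem exists_walk (k : ℕ) : ∀ {x y : LVertex}, piUnit ^ k • latOf y ≤ latOf x →
    ∃ p : tree.Walk (.inl x) (.inl y), p.length ≤ 2 * k := by
  induction k with
  | zero =>
    intro x y h
    rw [pow_zero, one_smul] at h
    have h2 := dual_anti h
    rw [(selfDual_latOf x).2, (selfDual_latOf y).2] at h2
    obtain rfl := latOf_injective (le_antisymm h2 h)
    exact ⟨.nil, by simp⟩
  | succ k ih =>
    intro x y h
    by_cases hP : piUnit ^ k • latOf y ≤ latOf x
    · obtain ⟨p, hp⟩ := ih hP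
      exact ⟨p, by omega⟩
    have hx := selfDual_latOf x
    have hy := selfDual_latOf y
    set L := latOf x with hL
    set L' := latOf y
    set P := piUnit ^ k • L' with hPdef
    have hpiP : piUnit • P ≤ L := by rwa [hPdef, smul_smul, ← pow_succ']
    have hPd : dual P = (piUnit ^ k)⁻¹ • L' := by rw [hPdef, dual_smul, hy.2]
    have hPPd : P ≤ dual P := by
      rw [hPd]
      exact smul_le_smul_of_ord_le (by rw [ord_inv, ord_pow, ord_pi]; omega) _
    have hpiL : piUnit • L ≤ L := smul_le_of_nonneg (by rw [ord_pi]; norm_num) L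
    have hpiPP : piUnit • P ≤ P := smul_le_of_nonneg (by rw [ord_pi]; norm_num) P
    have hLdP : piUnit • L ≤ dual P := by
      have := dual_anti hpiP
      rw [hx.2, dual_smul] at this
      have := smul_le_smul_iff (c := piUnit).2 this
      rwa [smul_inv_smul] at this
    set B := L ⊔ P with hBdef
    have hLB : L < B := lt_of_le_of_ne le_sup_left fun e => hP (e ▸ le_sup_right)
    have hBle : B ≤ piUnit⁻¹ • L := by
      have a1 : L ≤ piUnit⁻¹ • L := by
        rw [← smul_le_smul_iff (c := piUnit), smul_inv_smul]; exact hpiL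
      have a2 : P ≤ piUnit⁻¹ • L := by
        rw [← smul_le_smul_iff (c := piUnit), smul_inv_smul]; exact hpiP
      exact sup_le a1 a2
    have hB : IsLat B := hx.1.of_le_of_le (hx.1.smul _) hLB.le hBle
    have hM : IsLat (dual B) := hB.dual
    have hMeq : dual B = L ⊓ dual P := by rw [hBdef, dual_sup, hx.2]
    have hML : dual B < L := by
      have := hx.1.dual_lt hB hLB
      rwa [hx.2] at this
    -- Strictness comes from `pi_smul_ne_dual`, where the odd rank enters.
    have hpiB : piUnit • B < dual B := by
      refine lt_of_le_of_ne ?_ (pi_smul_ne_dual hB)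
      rw [hMeq, ← smul_le_smul_iff (c := piUnit⁻¹), inv_smul_smul]
      refine sup_le ?_ ?_
      · rw [← smul_le_smul_iff (c := piUnit), smul_inv_smul]
        exact le_inf hpiL hLdP
      · rw [← smul_le_smul_iff (c := piUnit), smul_inv_smul]
        exact le_inf hpiP (hpiPP.trans hPPd)
    set L₁ := dual B ⊔ P with hL₁
    -- The modular law `(P + L) ∩ P^# = P + (L ∩ P^#)`, available because `P ≤ P^#`.
    have hself : dual L₁ = L₁ := by
      rw [hL₁, dual_sup, hB.dual_dual, hMeq, hBdef, sup_comm L P, sup_inf_assoc_of_le L hPPd, sup_comm]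
    have hL₁B : L₁ ≤ B := sup_le (hML.le.trans hLB.le) le_sup_right
    have hML₁ : dual B ≤ L₁ := le_sup_left
    have hL₁lat : IsLat L₁ := hM.of_le_of_le hB hML₁ hL₁B
    have hne1 : dual B ≠ L₁ := by
      intro e
      have e2 := congrArg dual e
      rw [hB.dual_dual, hself, ← e] at e2
      exact absurd (hML.trans hLB) (e2 ▸ lt_irrefl _)
    have hne2 : L₁ ≠ B := by
      intro e
      have e2 := congrArg dual e
      rw [hself] at e2
      exact hne1 e2.symm
    obtain ⟨z, hz⟩ := exists_latOf_eq ⟨hL₁lat, hself⟩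
    obtain ⟨p, hp⟩ := ih (x := z) (y := y) (hz ▸ le_sup_right)
    obtain ⟨e, he, hi⟩ := exists_rep_incident hM (by rwa [hB.dual_dual]) hML
      (by rw [hB.dual_dual]; exact hLB)
    have hi' : Incident z e := he.incident (hz ▸ lt_of_le_of_ne hML₁ hne1)
      (by rw [hB.dual_dual, hz]; exact lt_of_le_of_ne hL₁B hne2)
    have hadj : tree.Adj (.inl x) (.inr e) := hi
    have hadj' : tree.Adj (.inr e) (.inl z) := hi'
    refine ⟨.cons hadj (.cons hadj' p), ?_⟩
    simp only [SimpleGraph.Walk.length_cons]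
    omega

/-! ## Ninth cyclotomic integers and their lengths -/

theorem star_xi_pow_two : star (xi ^ 2) = xi ^ 7 := by
  rw [star_pow, star_xi]
  linear_combination xi ^ 7 * xi_pow_nine

theorem star_xi_pow_three : star (xi ^ 3) = xi ^ 6 := by
  rw [star_pow, star_xi]
  linear_combination (xi ^ 15 + xi ^ 6) * xi_pow_nine

/-- The coefficient of `1` in the basis `1, ξ, …, ξ⁵`. -/
def coeffZero : E →ₗ[ℚ] ℚ :=
  (xi_spec.powerBasis ℚ).basis.coord ⟨0, (xi_spec.powerBasis ℚ).dim_pos⟩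

theorem coeffZero_xi_pow {n : ℕ} (hn : n < 6) : coeffZero (xi ^ n) = if n = 0 then 1 else 0 := by
  have hdim : (xi_spec.powerBasis ℚ).dim = 6 := by
    rw [← PowerBasis.finrank, IsCyclotomicExtension.finrank (n := 9) E
      (Polynomial.cyclotomic.irreducible_rat (by norm_num))]
    decide
  have h := (xi_spec.powerBasis ℚ).basis_eq_pow ⟨n, by rw [hdim]; exact hn⟩
  rw [IsPrimitiveRoot.powerBasis_gen ℚ xi_spec] at h
  change (xi_spec.powerBasis ℚ).basis.coord _ (xi ^ n) = _
  rw [← h, Module.Basis.coord_apply, Module.Basis.repr_self, Finsupp.single_apply]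
  simp [Fin.ext_iff]

theorem coeffZero_int_mul (n : ℤ) (x : E) : coeffZero (n * x) = n * coeffZero x := by
  rw [← zsmul_eq_mul, map_zsmul, zsmul_eq_mul]

theorem coeffZero_combination (n a b c d : ℤ) :
    coeffZero (n + a * xi + b * xi ^ 2 + c * xi ^ 4 + d * xi ^ 5) = n := by
  have h0 := coeffZero_xi_pow (n := 0) (by norm_num)
  have h1 := coeffZero_xi_pow (n := 1) (by norm_num)
  rw [pow_zero] at h0
  rw [pow_one] at h1
  rw [← mul_one (n : E)]
  simp only [map_add, coeffZero_int_mul, h0, h1, coeffZero_xi_pow (show 2 < 6 by norm_num),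
    coeffZero_xi_pow (show 4 < 6 by norm_num), coeffZero_xi_pow (show 5 < 6 by norm_num)]
  norm_num

theorem xi_pow_mod (n : ℕ) : xi ^ n = xi ^ (n % 9) := by
  conv_lhs => rw [← Nat.div_add_mod n 9, pow_add, pow_mul, xi_pow_nine, one_pow, one_mul]

theorem exists_coords {a : E} (ha : a ∈ Algebra.adjoin ℤ {xi}) :
    ∃ x0 y0 x1 y1 x2 y2 : ℤ, a = x0 + y0 * xi ^ 3 + xi * (x1 + y1 * xi ^ 3) +
      xi ^ 2 * (x2 + y2 * xi ^ 3) := by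
  rw [Algebra.adjoin_singleton_eq_range_aeval] at ha
  obtain ⟨p, rfl⟩ := ha
  change ∃ x0 y0 x1 y1 x2 y2 : ℤ, Polynomial.aeval xi p = _
  induction p using Polynomial.induction_on' with
  | add p q hp hq =>
    obtain ⟨x0, y0, x1, y1, x2, y2, hp⟩ := hp
    obtain ⟨z0, w0, z1, w1, z2, w2, hq⟩ := hq
    refine ⟨x0 + z0, y0 + w0, x1 + z1, y1 + w1, x2 + z2, y2 + w2, ?_⟩
    rw [map_add, hp, hq]
    push_cast
    ring
  | monomial n c =>
    rw [Polynomial.aeval_monomial, xi_pow_mod n]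
    have hlt : n % 9 < 9 := Nat.mod_lt _ (by norm_num)
    have hc : algebraMap ℤ E c = (c : E) := by simp
    rw [hc]
    interval_cases n % 9
    · exact ⟨c, 0, 0, 0, 0, 0, by push_cast; ring⟩
    · exact ⟨0, 0, c, 0, 0, 0, by push_cast; ring⟩
    · exact ⟨0, 0, 0, 0, c, 0, by push_cast; ring⟩
    · exact ⟨0, c, 0, 0, 0, 0, by push_cast; ring⟩
    · exact ⟨0, 0, 0, c, 0, 0, by push_cast; ring⟩
    · exact ⟨0, 0, 0, 0, 0, c, by push_cast; ring⟩
    · exact ⟨-c, -c, 0, 0, 0, 0, by push_cast; linear_combination c * xi_sum⟩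
    · exact ⟨0, 0, -c, -c, 0, 0, by push_cast; linear_combination c * xi * xi_sum⟩
    · exact ⟨0, 0, 0, 0, -c, -c, by push_cast; linear_combination c * xi ^ 2 * xi_sum⟩

/-- The constant coefficient is the sum of three Eisenstein norms `x² - xy + y²`. No `ξ³` occurs,
because the part of `a ā` in `ℚ(ξ³)` is fixed by conjugation. -/
theorem mul_star_coords (x0 y0 x1 y1 x2 y2 : E) (a : E)
    (hx0 : star x0 = x0) (hy0 : star y0 = y0) (hx1 : star x1 = x1) (hy1 : star y1 = y1)
    (hx2 : star x2 = x2) (hy2 : star y2 = y2)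
    (ha : a = x0 + y0 * xi ^ 3 + xi * (x1 + y1 * xi ^ 3) + xi ^ 2 * (x2 + y2 * xi ^ 3)) :
    a * star a = (x0 * x0 - x0 * y0 + x1 * x1 - x1 * y1 + x2 * x2 - x2 * y2 + y0 * y0 + y1 * y1 + y2 * y2) +
      (x0 * x1 - x0 * x2 + x1 * x2 - x1 * y0 + x2 * y0 - x2 * y1 + y0 * y1 - y0 * y2 + y1 * y2) * xi +
      (-x0 * x1 + x0 * x2 - x1 * x2 + x1 * y0 - x2 * y0 + x2 * y1 - y0 * y1 + y0 * y2 - y1 * y2) * xi ^ 2 +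
      (-x0 * x2 + x0 * y1 + x0 * y2 - x1 * y0 + x1 * y2 - x2 * y1 - y0 * y2) * xi ^ 4 +
      (-x0 * x1 + x0 * y1 + x0 * y2 - x1 * x2 + x1 * y2 - x2 * y0 - y0 * y1 - y1 * y2) * xi ^ 5 := by
  have hs : star a = x0 + y0 * xi ^ 6 + xi ^ 8 * (x1 + y1 * xi ^ 6) +
      xi ^ 7 * (x2 + y2 * xi ^ 6) := by
    rw [ha]
    simp only [star_add, star_mul', star_xi_pow_three, star_xi_pow_two, star_xi, hx0, hy0, hx1, hy1,
      hx2, hy2]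
  rw [hs, ha]
  linear_combination ((x0 * y0 - x1 * x1 + x1 * y1 - x2 * x2 + x2 * y2 - y0 * y0 - y1 * y1 - y2 * y2) * xi ^ 0 +
      (x0 * x2 - x1 * x2 + x1 * y0 - x2 * y0 + x2 * y1 - y0 * y1 + y0 * y2 - y1 * y2) * xi ^ 1 +
      (x0 * x1 + x1 * x2 - x1 * y0 + x2 * y0 - x2 * y1 + y0 * y1 - y0 * y2 + y1 * y2) * xi ^ 2 +
      (x1 * x1 - x1 * y1 + x2 * x2 - x2 * y2 + y0 * y0 + y1 * y1 + y2 * y2) * xi ^ 3 +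
      (-x0 * y2 + x1 * x2 - x1 * y2 + x2 * y0 + y0 * y1 + y1 * y2) * xi ^ 4 +
      (-x0 * y1 + x1 * y0 - x1 * y2 + x2 * y1 + y0 * y2) * xi ^ 5 +
      (x0 * y2 + x1 * y2 - x2 * y1 - y0 * y2) * xi ^ 7 +
      (x0 * y1 + x1 * y2 - y0 * y1 - y1 * y2) * xi ^ 8 +
      (x1 * y1 + x2 * y2 - y1 * y1 - y2 * y2) * xi ^ 9 +
      (x2 * y1 + y0 * y2 - y1 * y2) * xi ^ 10 +
      (y0 * y1 + y1 * y2) * xi ^ 11 +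
      (y1 * y1 + y2 * y2) * xi ^ 12 +
      (y1 * y2) * xi ^ 13) * xi_sum

/-- The form `a ↦ Tr(a ā) / 6` on `ℤ[ξ]` takes natural values, vanishes only at `0`, and takes the
value `1` only at elements of absolute value `1`. -/
theorem exists_normForm {a : E} (ha : a ∈ Algebra.adjoin ℤ {xi}) :
    ∃ t : ℕ, coeffZero (a * star a) = t ∧ (t = 0 → a = 0) ∧ (t = 1 → a * star a = 1) := by
  obtain ⟨x0, y0, x1, y1, x2, y2, hcoord⟩ := exists_coords ha
  have hm := mul_star_coords x0 y0 x1 y1 x2 y2 a (by simp) (by simp) (by simp) (by simp) (by simp)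
    (by simp) hcoord
  have hnn : ∀ x y : ℤ, 0 ≤ x * x - x * y + y * y := fun x y => by
    nlinarith [sq_nonneg (x + y), sq_nonneg (x - y)]
  have hz : ∀ x y : ℤ, x * x - x * y + y * y = 0 → x = 0 ∧ y = 0 := fun x y hxy => by
    have h1 : x * x + y * y ≤ 0 := by nlinarith [sq_nonneg (x + y), sq_nonneg (x - y)]
    constructor <;> nlinarith [mul_self_nonneg x, mul_self_nonneg y]
  have h0 := hnn x0 y0
  have h1 := hnn x1 y1
  have h2 := hnn x2 y2
  set n0 := x0 * x0 - x0 * y0 + y0 * y0 with hn0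
  set n1 := x1 * x1 - x1 * y1 + y1 * y1 with hn1
  set n2 := x2 * x2 - x2 * y2 + y2 * y2 with hn2
  have ht : ((n0 + n1 + n2).toNat : ℤ) = n0 + n1 + n2 := Int.toNat_of_nonneg (by positivity)
  refine ⟨(n0 + n1 + n2).toNat, ?_, fun h => ?_, fun h => ?_⟩
  · have hcomb := coeffZero_combination (n0 + n1 + n2)
      (x0 * x1 - x0 * x2 + x1 * x2 - x1 * y0 + x2 * y0 - x2 * y1 + y0 * y1 - y0 * y2 + y1 * y2)
      (-x0 * x1 + x0 * x2 - x1 * x2 + x1 * y0 - x2 * y0 + x2 * y1 - y0 * y1 + y0 * y2 - y1 * y2)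
      (-x0 * x2 + x0 * y1 + x0 * y2 - x1 * y0 + x1 * y2 - x2 * y1 - y0 * y2)
      (-x0 * x1 + x0 * y1 + x0 * y2 - x1 * x2 + x1 * y2 - x2 * y0 - y0 * y1 - y1 * y2)
    have ht' : (((n0 + n1 + n2).toNat : ℕ) : ℚ) = ((n0 + n1 + n2 : ℤ) : ℚ) := by
      exact_mod_cast congrArg (Int.cast (R := ℚ)) ht
    rw [ht', ← hcomb, hm]
    congr 1
    rw [hn0, hn1, hn2]
    push_cast
    ring
  · rw [h] at ht
    push_cast at ht
    obtain ⟨rfl, rfl⟩ := hz x0 y0 (by omega)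
    obtain ⟨rfl, rfl⟩ := hz x1 y1 (by omega)
    obtain ⟨rfl, rfl⟩ := hz x2 y2 (by omega)
    simpa using hcoord
  · rw [h] at ht
    push_cast at ht
    -- Total length 1 puts `a` in a single summand `ξ^i ℤ[ξ³]`, as an element of Eisenstein norm 1;
    -- all cross terms of `a ā` vanish.
    have hcase : (n0 = 1 ∧ n1 = 0 ∧ n2 = 0) ∨ (n0 = 0 ∧ n1 = 1 ∧ n2 = 0) ∨
      (n0 = 0 ∧ n1 = 0 ∧ n2 = 1) := by omega
    rcases hcase with ⟨a0, a1, a2⟩ | ⟨a0, a1, a2⟩ | ⟨a0, a1, a2⟩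
    · obtain ⟨rfl, rfl⟩ := hz _ _ a1
      obtain ⟨rfl, rfl⟩ := hz _ _ a2
      rw [hm]
      have := congrArg (Int.cast (R := E)) a0
      rw [hn0] at this
      push_cast at this ⊢
      linear_combination this
    · obtain ⟨rfl, rfl⟩ := hz _ _ a0
      obtain ⟨rfl, rfl⟩ := hz _ _ a2
      rw [hm]
      have := congrArg (Int.cast (R := E)) a1
      rw [hn1] at this
      push_cast at this ⊢
      linear_combination this
    · obtain ⟨rfl, rfl⟩ := hz _ _ a0
      obtain ⟨rfl, rfl⟩ := hz _ _ a1
      rw [hm]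
      have := congrArg (Int.cast (R := E)) a2
      rw [hn2] at this
      push_cast at this ⊢
      linear_combination this

/-! ### The element `delta` and rows of small Hermitian norm -/

theorem exists_embedding : ∃ φ : E →+* ℂ, φ xi = Complex.exp (2 * Real.pi * Complex.I / 9) := by
  have hω : IsPrimitiveRoot (Complex.exp (2 * Real.pi * Complex.I / (9 : ℕ))) 9 :=
    Complex.isPrimitiveRoot_exp 9 (by norm_num)
  have hirr : Irreducible (Polynomial.cyclotomic 9 ℚ) :=
    Polynomial.cyclotomic.irreducible_rat (by norm_num)
  let f := (xi_spec.embeddingsEquivPrimitiveRoots ℂ hirr).symm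
    ⟨_, (mem_primitiveRoots (by norm_num)).2 hω⟩
  refine ⟨f, ?_⟩
  have := xi_spec.embeddingsEquivPrimitiveRoots_apply_coe ℂ hirr f
  rw [Equiv.apply_symm_apply] at this
  simpa using this.symm

theorem map_mul_star (φ : E →+* ℂ) (x : E) : φ (x * star x) = ((Complex.normSq (φ x) : ℝ) : ℂ) := by
  have h1 : φ (star x) = starRingEnd ℂ (φ x) :=
    NumberField.IsCMField.complexEmbedding_complexConj E φ x
  rw [map_mul, h1, Complex.mul_conj]

/-- The generator `(1 - ξ)(1 - ξ²)` of `π² ℤ[ξ]`, chosen for its short length. -/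
def delta : E := (1 - xi) * (1 - xi ^ 2)

theorem coeffZero_delta : coeffZero (delta * star delta) = 3 := by
  have h : delta * star delta = ((3 : ℤ) : E) + ((1 : ℤ) : E) * xi + ((-1 : ℤ) : E) * xi ^ 2 +
      ((2 : ℤ) : E) * xi ^ 4 + ((1 : ℤ) : E) * xi ^ 5 := by
    rw [delta]
    simp only [star_mul', star_sub, star_one, star_xi_pow_two, star_xi]
    push_cast
    linear_combination (xi ^ 12 - xi ^ 11 - xi ^ 10 + xi ^ 8 + xi ^ 7 - xi ^ 6 - xi ^ 5 + 3 * xi ^ 3 -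
      2 * xi - 2) * xi_sum
  rw [h, coeffZero_combination]
  norm_num

/-- The value is `(2 - 2 cos(2π/9)) (2 - 2 cos(4π/9))`. From `cos(2π/9) > 3/4` and `cos(4π/9) > 0`
the factors are below `1/2` and `2`. -/
theorem normSq_delta_lt {φ : E →+* ℂ} (hφ : φ xi = Complex.exp (2 * Real.pi * Complex.I / 9)) :
    Complex.normSq (φ delta) < 1 := by
  have h1 : φ xi = Complex.exp ((2 * Real.pi / 9 : ℝ) * Complex.I) := by
    rw [hφ]; congr 1; push_cast; ring
  have h2 : φ xi ^ 2 = Complex.exp ((4 * Real.pi / 9 : ℝ) * Complex.I) := by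
    rw [h1, ← Complex.exp_nat_mul]; congr 1; push_cast; ring
  have key : ∀ θ : ℝ, Complex.normSq (1 - Complex.exp (θ * Complex.I)) = 2 - 2 * Real.cos θ := by
    intro θ
    rw [Complex.normSq_apply]
    simp only [Complex.sub_re, Complex.one_re, Complex.sub_im, Complex.one_im,
      Complex.exp_ofReal_mul_I_re, Complex.exp_ofReal_mul_I_im]
    nlinarith [Real.sin_sq_add_cos_sq θ]
  rw [delta, map_mul, map_sub, map_sub, map_pow, map_one, map_mul, h2, h1, key, key]
  have hpi := Real.pi_lt_d2
  have hpi0 := Real.pi_pos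
  have c1 : 1 - (2 * Real.pi / 9) ^ 2 / 2 ≤ Real.cos (2 * Real.pi / 9) :=
    Real.one_sub_sq_div_two_le_cos
  have c2 : 0 < Real.cos (4 * Real.pi / 9) :=
    Real.cos_pos_of_mem_Ioo ⟨by linarith, by linarith⟩
  have c3 := Real.cos_le_one (4 * Real.pi / 9)
  have c4 : (3 / 4 : ℝ) < Real.cos (2 * Real.pi / 9) := by
    have : (2 * Real.pi / 9) ^ 2 < (0.7 : ℝ) ^ 2 := by
      apply pow_lt_pow_left₀ _ (by positivity) (by norm_num)
      linarith
    linarith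
  nlinarith

theorem exists_forall_ne_eq_zero {t : Fin 3 → ℕ}
    (h : (t 1 = 0 ∧ t 2 = 0) ∨ (t 0 = 0 ∧ t 2 = 0) ∨ (t 0 = 0 ∧ t 1 = 0)) :
    ∃ i, ∀ j, j ≠ i → t j = 0 := by
  rcases h with ⟨p, q⟩ | ⟨p, q⟩ | ⟨p, q⟩
  · refine ⟨0, fun j hj => ?_⟩
    fin_cases j <;> first | exact absurd rfl hj | assumption
  · refine ⟨1, fun j hj => ?_⟩
    fin_cases j <;> first | exact absurd rfl hj | assumption
  · refine ⟨2, fun j hj => ?_⟩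
    fin_cases j <;> first | exact absurd rfl hj | assumption

theorem exists_row_of_sum_eq_one {a : Fin 3 → E} (ha : ∀ i, a i ∈ Algebra.adjoin ℤ {xi})
    (h : ∑ i, a i * star (a i) = 1) : ∃ i, ∀ j, j ≠ i → a j = 0 := by
  choose t ht h0 _ using fun i => exists_normForm (ha i)
  have hsum := congrArg coeffZero h
  have h1 := coeffZero_xi_pow (n := 0) (by norm_num)
  rw [pow_zero] at h1
  rw [map_sum, h1, Fin.sum_univ_three, ht, ht, ht] at hsum
  have hs : t 0 + t 1 + t 2 = 1 := by exact_mod_cast hsum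
  obtain ⟨i, hi⟩ := exists_forall_ne_eq_zero (t := t) (by omega)
  exact ⟨i, fun j hj => h0 j (hi j hj)⟩

/-- The lengths of the entries add up to 3. An entry of length 1 has absolute value 1 everywhere,
too large in the embedding where `delta` is small. Without ones, the only partition of 3 into three
parts is `3 + 0 + 0`. -/
theorem exists_row_of_sum_eq_delta {a : Fin 3 → E} (ha : ∀ i, a i ∈ Algebra.adjoin ℤ {xi})
    (h : ∑ i, a i * star (a i) = delta * star delta) : ∃ i, ∀ j, j ≠ i → a j = 0 := by
  choose t ht h0 h1 using fun i => exists_normForm (ha i)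
  have hsum := congrArg coeffZero h
  rw [map_sum, coeffZero_delta, Fin.sum_univ_three, ht, ht, ht] at hsum
  have hs : t 0 + t 1 + t 2 = 3 := by exact_mod_cast hsum
  have hne : ∀ i, t i ≠ 1 := by
    intro i hi
    obtain ⟨φ, hφ⟩ := exists_embedding
    have h2 := congrArg φ h
    rw [map_sum] at h2
    simp only [map_mul_star] at h2
    have h3 : ∑ i, Complex.normSq (φ (a i)) = Complex.normSq (φ delta) := by exact_mod_cast h2
    have h4 : Complex.normSq (φ (a i)) = 1 := by
      have := congrArg φ (h1 i hi)
      rw [map_mul_star, map_one] at this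
      exact_mod_cast this
    have h5 := Finset.single_le_sum (f := fun i => Complex.normSq (φ (a i)))
      (fun i _ => Complex.normSq_nonneg _) (Finset.mem_univ i)
    rw [h3] at h5
    have := normSq_delta_lt hφ
    simp only [h4] at h5
    linarith
  have n0 := hne 0
  have n1 := hne 1
  have n2 := hne 2
  obtain ⟨i, hi⟩ := exists_forall_ne_eq_zero (t := t) (by omega)
  exact ⟨i, fun j hj => h0 j (hi j hj)⟩

/-! ### Elements of `ℤ[ξ, 1/3]` integral at `π` -/

theorem exists_pow_mul_mem {x : E} (hx : x ∈ ringR) :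
    ∃ m : ℕ, (1 - xi) ^ m * x ∈ Algebra.adjoin ℤ {xi} := by
  have hxi : xi ∈ Algebra.adjoin ℤ {xi} := Algebra.subset_adjoin rfl
  have h1 : (1 - xi) ∈ Algebra.adjoin ℤ {xi} := sub_mem (one_mem _) hxi
  induction hx using Algebra.adjoin_induction with
  | mem x hx =>
    rcases hx with rfl | rfl
    · exact ⟨0, by simp⟩
    -- The prime 3 is totally ramified of degree 6, so `(1 - ξ)^6` is a multiple of 3.
    · refine ⟨6, ?_⟩
      have e : (1 - xi) ^ 6 * (1 / 3) = ((-2 : ℤ) : E) * xi + ((5 : ℤ) : E) * xi ^ 2 +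
          ((-7 : ℤ) : E) * xi ^ 3 + ((5 : ℤ) : E) * xi ^ 4 + ((-2 : ℤ) : E) * xi ^ 5 := by
        push_cast
        linear_combination (1 / 3 : E) * xi_sum
      rw [e]
      have hm : ∀ (n : ℤ) (k : ℕ), (n : E) * xi ^ k ∈ Algebra.adjoin ℤ {xi} := fun n k =>
        mul_mem (intCast_mem _ n) (pow_mem hxi k)
      exact add_mem (add_mem (add_mem (add_mem (mul_mem (intCast_mem _ _) hxi) (hm _ _)) (hm _ _)) (hm _ _)) (hm _ _)
  | algebraMap r => exact ⟨0, by simp⟩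
  | add x y _ _ hx hy =>
    obtain ⟨n, hn⟩ := hx
    obtain ⟨m, hm⟩ := hy
    refine ⟨n + m, ?_⟩
    have := add_mem (mul_mem (pow_mem h1 m) hn) (mul_mem (pow_mem h1 n) hm)
    convert this using 1
    ring
  | mul x y _ _ hx hy =>
    obtain ⟨n, hn⟩ := hx
    obtain ⟨m, hm⟩ := hy
    refine ⟨n + m, ?_⟩
    have := mul_mem hn hm
    convert this using 1
    ring

theorem coe_piInt : (piInt : E) = 1 - xi := by
  simp only [piInt, map_sub, map_one]
  rfl

/-- Denominators in `ringR` are powers of `π`, and integrality at `π` lets such a power be divided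
out. -/
theorem mem_adjoin_of_mem_Opi {x : E} (hx : x ∈ ringR) (h : algebraMap E Epi x ∈ Opi) :
    x ∈ Algebra.adjoin ℤ {xi} := by
  obtain ⟨m, hm⟩ := exists_pow_mul_mem hx
  obtain ⟨r, hr⟩ := adjoin_xi_integral hm
  have h1 : piPlace.valuation E x ≤ 1 := by
    rw [← valued_algebraMap]
    exact h
  have h2 : piPlace.intValuation r ≤ WithZero.exp (-(m : ℤ)) := by
    rw [← piPlace.valuation_of_algebraMap (K := E)]
    change piPlace.valuation E (r : E) ≤ _
    rw [hr, map_mul, map_pow, ← coe_piInt, piPlace.valuation_of_algebraMap,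
      piPlace.intValuation_singleton prime_piInt.ne_zero rfl, ← WithZero.exp_nsmul]
    simpa using h1
  rw [piPlace.intValuation_le_pow_iff_mem] at h2
  change r ∈ Ideal.span {piInt} ^ m at h2
  rw [Ideal.span_singleton_pow, Ideal.mem_span_singleton] at h2
  obtain ⟨s, rfl⟩ := h2
  have h3 : x = s := by
    have h4 : (1 - xi) ^ m ≠ 0 := by
      rw [← coe_piInt]
      exact pow_ne_zero _ (by simpa using prime_piInt.ne_zero)
    apply mul_left_cancel₀ h4
    rw [← hr, ← coe_piInt]
    simp
  rw [h3]
  exact mem_adjoin_xi s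

/-! ## The action on the tree -/

theorem adj_smul (g : Matrix.unitaryGroup (Fin 3) E) {u v : Vertex} (h : tree.Adj u v) :
    tree.Adj (g • u) (g • v) := by
  have key : ∀ (x : LVertex) (e : RVertex), Incident x e → Incident (toGPi g • x) (toGPi g • e) := by
    rintro x e ⟨y, z, he, ht⟩
    refine ⟨toGPi g • y, toGPi g • z, ?_, ht.smul _⟩
    change e.1.map (toGPi g • ·) = _
    rw [he]
    rfl
  rcases u with x | e <;> rcases v with y | f
  · exact h.elim
  · exact key x f h
  · exact key y e h
  · exact h.elim

/-- The action of a unitary matrix as a graph homomorphism. -/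
def smulHom (g : Matrix.unitaryGroup (Fin 3) E) : tree →g tree where
  toFun := (g • ·)
  map_rel' := adj_smul g

theorem reachable_smul (g : Matrix.unitaryGroup (Fin 3) E) {u v : Vertex} (h : tree.Reachable u v) :
    tree.Reachable (g • u) (g • v) := h.map (smulHom g)

theorem dist_smul_le (g : Matrix.unitaryGroup (Fin 3) E) {u v : Vertex} (h : tree.Reachable u v) :
    tree.dist (g • u) (g • v) ≤ tree.dist u v := by
  obtain ⟨p, hp⟩ := h.exists_walk_length_eq_dist
  have := SimpleGraph.dist_le (p.map (smulHom g))
  rwa [SimpleGraph.Walk.length_map, hp] at this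

theorem mem_sphere_smul (g : Matrix.unitaryGroup (Fin 3) E) {n : ℕ} {u v : Vertex}
    (h : u ∈ sphere n v) : g • u ∈ sphere n (g • v) := by
  obtain ⟨h1, h2⟩ := h
  refine ⟨reachable_smul g h1, ?_⟩
  refine le_antisymm (h2 ▸ dist_smul_le g h1) ?_
  have := dist_smul_le g⁻¹ (reachable_smul g h1)
  rwa [inv_smul_smul, inv_smul_smul, h2] at this

theorem mem_clan_smul (g : Matrix.unitaryGroup (Fin 3) E) {u v p : Vertex} (h : u ∈ clan v p) :
    g • u ∈ clan (g • v) (g • p) := ⟨mem_sphere_smul g h.1, mem_sphere_smul g h.2⟩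

theorem clan_smul (g : Matrix.unitaryGroup (Fin 3) E) (v p : Vertex) :
    clan (g • v) (g • p) = (g • ·) '' clan v p := by
  ext u
  constructor
  · intro h
    refine ⟨g⁻¹ • u, ?_, smul_inv_smul g u⟩
    have := mem_clan_smul g⁻¹ h
    rwa [inv_smul_smul, inv_smul_smul] at this
  · rintro ⟨w, hw, rfl⟩
    exact mem_clan_smul g hw

theorem clans_smul (g : Matrix.unitaryGroup (Fin 3) E) (v : Vertex) :
    clans (g • v) = (Set.image (g • ·)) '' clans v := by
  ext c
  constructor
  · rintro ⟨p, hp, rfl⟩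
    have := mem_sphere_smul g⁻¹ hp
    rw [inv_smul_smul] at this
    refine ⟨_, ⟨g⁻¹ • p, this, rfl⟩, ?_⟩
    rw [← clan_smul, smul_inv_smul]
  · rintro ⟨_, ⟨p, hp, rfl⟩, rfl⟩
    exact ⟨g • p, mem_sphere_smul g hp, (clan_smul g v p).symm⟩

/-! ### Spheres -/

theorem exists_between {u v : Vertex} (h : tree.Reachable u v) {m : ℕ}
    (hm : m ≤ tree.dist u v) :
    ∃ p ∈ sphere m u, v ∈ sphere (tree.dist u v - m) p := by
  obtain ⟨w, hw⟩ := h.exists_walk_length_eq_dist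
  have h1 := SimpleGraph.dist_le (w.take m)
  have h2 := SimpleGraph.dist_le (w.drop m)
  rw [SimpleGraph.Walk.take_length] at h1
  rw [SimpleGraph.Walk.drop_length] at h2
  have r1 : tree.Reachable u (w.getVert m) := ⟨w.take m⟩
  have r2 : tree.Reachable (w.getVert m) v := ⟨w.drop m⟩
  have h3 := r1.dist_triangle_left v
  exact ⟨w.getVert m, ⟨r1, by omega⟩, ⟨r2, by omega⟩⟩

theorem sphere_succ_subset (n : ℕ) (v : Vertex) :
    sphere (n + 1) v ⊆ ⋃ p ∈ sphere n v, tree.neighborSet p ∩ sphere (n + 1) v := by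
  rintro u hu
  obtain ⟨p, hp, hup⟩ := exists_between hu.1 (m := n) (by rw [hu.2]; omega)
  rw [hu.2, Nat.add_sub_cancel_left] at hup
  exact Set.mem_biUnion hp ⟨SimpleGraph.dist_eq_one_iff_adj.1 hup.2, hu⟩

theorem ncard_biUnion_le {α β : Type*} {s : Set α} (hs : s.Finite) {f : α → Set β}
    (hf : ∀ a ∈ s, (f a).Finite) {k : ℕ} (hk : ∀ a ∈ s, (f a).ncard ≤ k) :
    (⋃ a ∈ s, f a).Finite ∧ (⋃ a ∈ s, f a).ncard ≤ s.ncard * k := by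
  classical
  refine ⟨hs.biUnion hf, ?_⟩
  induction s, hs using Set.Finite.induction_on with
  | empty => simp
  | @insert a s ha hs ih =>
    rw [Set.biUnion_insert, Set.ncard_insert_of_notMem ha hs]
    have h1 := ih (fun b hb => hf b (Set.mem_insert_of_mem _ hb))
      (fun b hb => hk b (Set.mem_insert_of_mem _ hb))
    have h2 := hk a (Set.mem_insert _ _)
    have h3 := Set.ncard_union_le (f a) (⋃ x ∈ s, f x)
    rw [add_mul, one_mul]
    omega

/-- Of the at most four neighbours of a point on a sphere, one leads back towards the centre. -/
theorem sphere_finite (n : ℕ) (v : Vertex) :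
    (sphere (n + 1) v).Finite ∧ (sphere (n + 1) v).ncard ≤ 4 * 3 ^ n := by
  induction n with
  | zero =>
    have hsub : sphere 1 v ⊆ tree.neighborSet v := fun u hu =>
      SimpleGraph.dist_eq_one_iff_adj.1 hu.2
    have h := neighborSet_finite v
    exact ⟨h.1.subset hsub, (Set.ncard_le_ncard hsub h.1).trans (by simpa using h.2)⟩
  | succ n ih =>
    have hle : ∀ p ∈ sphere (n + 1) v,
        (tree.neighborSet p ∩ sphere (n + 1 + 1) v).ncard ≤ 3 := by
      intro p hp
      have hN := neighborSet_finite p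
      obtain ⟨q, hq, hpq⟩ := exists_between hp.1 (m := n) (by rw [hp.2]; omega)
      rw [hp.2, Nat.add_sub_cancel_left] at hpq
      have hqp : q ∈ tree.neighborSet p := (SimpleGraph.dist_eq_one_iff_adj.1 hpq.2).symm
      have hsub : tree.neighborSet p ∩ sphere (n + 1 + 1) v ⊆ tree.neighborSet p \ {q} := by
        rintro u ⟨hu, hu2⟩
        refine ⟨hu, ?_⟩
        rintro rfl
        have := hu2.2
        rw [hq.2] at this
        omega
      have h1 := Set.ncard_le_ncard hsub (hN.1.subset Set.sdiff_subset)
      rw [Set.ncard_sdiff_singleton_of_mem hqp] at h1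
      omega
    have h := ncard_biUnion_le ih.1 (f := fun p => tree.neighborSet p ∩ sphere (n + 1 + 1) v)
      (fun p _ => (neighborSet_finite p).1.subset Set.inter_subset_left) hle
    refine ⟨h.1.subset (sphere_succ_subset _ v), ?_⟩
    refine (Set.ncard_le_ncard (sphere_succ_subset _ v) h.1).trans (h.2.trans ?_)
    rw [pow_succ]
    nlinarith [ih.2]

/-! ### The orbit of the base vertex -/

/-- The base vertex as a vertex of `ℬ` fixed by `#`. -/
def baseL : LVertex := ⟨((1 : GLpi) : BVertex), by rw [sharpB_mk, map_one]⟩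

theorem latOf_smul_base (g : Matrix.unitaryGroup (Fin 3) E) :
    latOf (toGPi g • baseL) = lattice (Unitary.toUnits (toGPi g)) := by
  have h1 : ((Unitary.toUnits (toGPi g) : GLpi) : BVertex) = (toGPi g • baseL).1 := by
    change _ = ((Unitary.toUnits (toGPi g) * 1 : GLpi) : BVertex)
    rw [mul_one]
  refine latOf_eq h1 ?_
  rw [dual_lattice, sharp_toUnits]

theorem latOf_base : latOf baseL = lattice 1 := by
  refine latOf_eq rfl ?_
  rw [dual_lattice, map_one]

/-- The bridge from distances to arithmetic: the displacement of `v0` measures the power of `π` in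
the denominators of `g`. -/
theorem pow_smul_le_base_iff (g : Matrix.unitaryGroup (Fin 3) E) (k : ℕ) :
    piUnit ^ k • latOf (toGPi g • baseL) ≤ latOf baseL ↔
      ∀ i j, algebraMap E Epi ((1 - xi) ^ k * g.1 i j) ∈ Opi := by
  rw [latOf_smul_base, latOf_base, ← lattice_scalar_mul, lattice_le_iff]
  refine forall₂_congr fun i j => ?_
  rw [inv_one, one_mul]
  have : (Matrix.GeneralLinearGroup.scalar (Fin 3) (piUnit ^ k) *
      Unitary.toUnits (toGPi g) : GLpi).val i j = algebraMap E Epi ((1 - xi) ^ k * g.1 i j) := by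
    rw [map_mul (algebraMap E Epi), map_pow (algebraMap E Epi)]
    change (Matrix.scalar (Fin 3) ((piUnit ^ k : Epiˣ) : Epi) * (g.1.map (algebraMap E Epi))) i j = _
    rw [Matrix.scalar_apply, Matrix.diagonal_mul, Units.val_pow_eq_pow_val]
    rfl
  rw [this]

theorem smul_v0_eq (g : Matrix.unitaryGroup (Fin 3) E) : g • v0 = .inl (toGPi g • baseL) := rfl

theorem exists_walk_smul_v0 (g : Matrix.unitaryGroup (Fin 3) E) {k : ℕ}
    (h : ∀ i j, algebraMap E Epi ((1 - xi) ^ k * g.1 i j) ∈ Opi) :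
    tree.Reachable v0 (g • v0) ∧ tree.dist v0 (g • v0) ≤ 2 * k := by
  obtain ⟨p, hp⟩ := exists_walk k ((pow_smul_le_base_iff g k).2 h)
  exact ⟨⟨p⟩, (SimpleGraph.dist_le p).trans hp⟩

theorem exists_dist_eq (g : Matrix.unitaryGroup (Fin 3) E) (h : tree.Reachable v0 (g • v0)) :
    ∃ k, tree.dist v0 (g • v0) = 2 * k ∧
      ∀ i j, algebraMap E Epi ((1 - xi) ^ k * g.1 i j) ∈ Opi := by
  obtain ⟨p, hp⟩ := h.exists_walk_length_eq_dist
  obtain ⟨k, hk, hl⟩ := walk_lipschitz _ (x := baseL) (y := toGPi g • baseL) p rfl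
  exact ⟨k, hp ▸ hk, (pow_smul_le_base_iff g k).1 hl⟩

theorem smul_v0_eq_iff (g : Matrix.unitaryGroup (Fin 3) E) :
    g • v0 = v0 ↔ ∀ i j, algebraMap E Epi (g.1 i j) ∈ Opi := by
  constructor
  · intro h
    have h1 : toGPi g • baseL = baseL := by
      rw [smul_v0_eq] at h
      exact Sum.inl.inj h
    have := (pow_smul_le_base_iff g 0).1 (by rw [h1, pow_zero, one_smul])
    simpa using this
  · intro h
    obtain ⟨h1, h2⟩ := exists_walk_smul_v0 g (k := 0) (by simpa using h)
    exact ((h1.dist_eq_zero_iff).1 (by omega)).symm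

theorem reachable_smul_v0 (g : Matrix.unitaryGroup (Fin 3) E) : tree.Reachable v0 (g • v0) := by
  have h : ∀ x : E, ∃ n : ℕ, ∀ m ≥ n, algebraMap E Epi ((1 - xi) ^ m * x) ∈ Opi := by
    intro x
    obtain ⟨c, hc⟩ := exists_smul_mem_lattice 1 (fun _ => algebraMap E Epi x)
    have hc' : (c : Epi) * algebraMap E Epi x ∈ Opi := by
      have := mem_lattice.1 hc 0
      rw [inv_one, Units.val_one, Matrix.one_mulVec] at this
      exact this
    refine ⟨(ord c).toNat, fun m hm => ?_⟩
    have h1 : ((piUnit ^ m * c⁻¹ : Epiˣ) : Epi) ∈ Opi := by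
      rw [unit_mem_Opi_iff, ord_mul, ord_pow, ord_pi, ord_inv]
      have := Int.self_le_toNat (ord c)
      have : ((ord c).toNat : ℤ) ≤ m := by exact_mod_cast hm
      linarith
    have h2 := mul_mem h1 hc'
    convert h2 using 1
    rw [map_mul, map_pow, Units.val_mul, Units.val_pow_eq_pow_val, mul_assoc,
      Units.inv_mul_cancel_left]
    rfl
  choose n hn using h
  refine (exists_walk_smul_v0 g (k := ∑ i, ∑ j, n (g.1 i j)) fun i j => hn _ _ ?_).1
  calc n (g.1 i j) ≤ ∑ j, n (g.1 i j) :=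
        Finset.single_le_sum (f := fun j => n (g.1 i j)) (fun _ _ => Nat.zero_le _) (Finset.mem_univ j)
    _ ≤ _ := Finset.single_le_sum (f := fun i => ∑ j, n (g.1 i j)) (fun _ _ => Nat.zero_le _)
        (Finset.mem_univ i)

/-! ## Short displacements in `Γ` -/

theorem delta_ne_zero : delta ≠ 0 := by
  intro h
  have := coeffZero_delta
  rw [h, zero_mul, map_zero] at this
  norm_num at this

theorem sum_row_mul_star (g : Matrix.unitaryGroup (Fin 3) E) (i : Fin 3) :
    ∑ j, g.1 i j * star (g.1 i j) = 1 := by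
  have h := congrFun (congrFun ((Matrix.mem_unitaryGroup_iff).1 g.2) i) i
  rw [Matrix.mul_apply, Matrix.one_apply_eq] at h
  exact h

theorem sum_col_mul_star (g : Matrix.unitaryGroup (Fin 3) E) (j : Fin 3) :
    ∑ i, g.1 i j * star (g.1 i j) = 1 := by
  have h := congrFun (congrFun ((Matrix.mem_unitaryGroup_iff').1 g.2) j) j
  rw [Matrix.mul_apply, Matrix.one_apply_eq] at h
  rw [← h]
  exact Finset.sum_congr rfl fun i _ => mul_comm _ _

theorem mem_Opi_of_mul_star_eq_one {x : E} (h : x * star x = 1) : algebraMap E Epi x ∈ Opi := by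
  have hx : algebraMap E Epi x ≠ 0 := by
    rw [map_ne_zero_iff _ (algebraMap E Epi).injective]
    rintro rfl
    simp at h
  let c : Epiˣ := Units.mk0 _ hx
  have h1 : c * star c = 1 := by
    ext1
    change algebraMap E Epi x * star (algebraMap E Epi x) = 1
    rw [star_algebraMap, ← map_mul, h, map_one]
  have h2 := congrArg ord h1
  rw [ord_mul, ord_star, ord_one] at h2
  exact (unit_mem_Opi_iff c).2 (by omega)

/-- The rigidity statement. A displacement `2k ≤ 4` makes `delta * g` a matrix over `ℤ[ξ]`; each row
has Hermitian norm `delta * star delta`, hence one nonzero entry, and the corresponding entry of `g`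
satisfies `x x̄ = 1`. -/
theorem smul_v0_eq_of_dist_le {g : Matrix.unitaryGroup (Fin 3) E} (hg : g ∈ Gam)
    (h : tree.dist v0 (g • v0) ≤ 4) : g • v0 = v0 := by
  obtain ⟨k, hk, hO⟩ := exists_dist_eq g (reachable_smul_v0 g)
  have hxi : xi ∈ Algebra.adjoin ℤ {xi} := Algebra.subset_adjoin rfl
  have hint : ∀ i j, delta * g.1 i j ∈ Algebra.adjoin ℤ {xi} := by
    intro i j
    have e : delta * g.1 i j = (1 + xi) * ((1 - xi) ^ 2 * g.1 i j) := by rw [delta]; ring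
    rw [e]
    refine mul_mem (add_mem (one_mem _) hxi) (mem_adjoin_of_mem_Opi ?_ ?_)
    · exact mul_mem (pow_mem (sub_mem (one_mem _) xi_mem_ringR) 2) (hg i j)
    · have e2 : (1 - xi) ^ 2 * g.1 i j = (1 - xi) ^ (2 - k) * ((1 - xi) ^ k * g.1 i j) := by
        rw [← mul_assoc, ← pow_add, Nat.sub_add_cancel (by omega)]
      rw [e2, map_mul, map_pow]
      exact mul_mem (pow_mem pi_mem_Opi _) (hO i j)
  rw [smul_v0_eq_iff]
  intro i
  have hsum : ∑ j, (delta * g.1 i j) * star (delta * g.1 i j) = delta * star delta := by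
    rw [← mul_one (delta * star delta), ← sum_row_mul_star g i, Finset.mul_sum]
    refine Finset.sum_congr rfl fun j _ => ?_
    rw [star_mul']
    ring
  obtain ⟨l, hl⟩ := exists_row_of_sum_eq_delta (hint i) hsum
  have hz : ∀ j, j ≠ l → g.1 i j = 0 := fun j hj =>
    (mul_eq_zero.1 (hl j hj)).resolve_left delta_ne_zero
  intro j
  by_cases hj : j = l
  · subst hj
    have h1 := sum_row_mul_star g i
    rw [Finset.sum_eq_single j (fun b _ hb => by rw [hz b hb, zero_mul]) (by simp)] at h1
    exact mem_Opi_of_mul_star_eq_one h1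
  · rw [hz j hj, map_zero]
    exact zero_mem _

/-- An element of `Γ` fixing the base vertex is monomial. -/
theorem exists_col_of_smul_v0_eq {g : Matrix.unitaryGroup (Fin 3) E} (hg : g ∈ Gam)
    (h : g • v0 = v0) (j : Fin 3) : ∃ i, ∀ l, l ≠ i → g.1 l j = 0 :=
  exists_row_of_sum_eq_one
    (fun i => mem_adjoin_of_mem_Opi (hg i j) ((smul_v0_eq_iff g).1 h i j)) (sum_col_mul_star g j)

/-! ## The elements `d H v₀` -/

/-- The parameters of representatives of the cosets of the stabilizer of `H v₀` in `𝒟`. -/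
abbrev Idx : Type := ℤˣ × ℤˣ × Fin 3 × Fin 9

/-- The elements `diag(1, ±ξ^a, ±ξ^b) H`. -/
def gam (i : Idx) : Gam :=
  gateDiag ![1, i.1, i.2.1] ![0, i.2.2.1, i.2.2.2] * gateH

theorem gam_mem_Lam (i : Idx) : gam i ∈ Lam :=
  mul_mem (Subgroup.subset_closure (Or.inr ⟨_, _, rfl⟩)) (Subgroup.subset_closure (Or.inl rfl))

theorem gam_apply (i : Idx) (p q : Fin 3) :
    (gam i).1.1 p q = ((![1, i.1, i.2.1] p : ℤˣ) : ℤ) * xi ^ (![0, (i.2.2.1 : ℕ), i.2.2.2] p) *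
      hMatrix p q := by
  change ((Matrix.diagonal fun p => ((![1, i.1, i.2.1] p : ℤ) : E) *
    xi ^ (![0, (i.2.2.1 : ℕ), i.2.2.2] p)) * hMatrix : Matrix (Fin 3) (Fin 3) E) p q = _
  rw [Matrix.diagonal_mul]

theorem hMatrix_eq (p q : Fin 3) :
    hMatrix p q = 1 / (xi ^ 3 - xi ^ 6) * xi ^ (3 * (p : ℕ) * q) := by
  rw [hMatrix, Matrix.smul_apply, smul_eq_mul]
  congr 1
  fin_cases p <;> fin_cases q <;> simp
  linear_combination (-xi ^ 3) * xi_pow_nine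

theorem sqrt_ne_zero : xi ^ 3 - xi ^ 6 ≠ 0 := by
  intro h
  have := xi_spec.pow_inj (i := 3) (j := 6) (by norm_num) (by norm_num) (sub_eq_zero.1 h)
  norm_num at this

theorem xi_ne_zero : xi ≠ 0 := xi_spec.ne_zero (by norm_num)

theorem sign_mul_xi_pow_inj {s t : ℤˣ} {a b : ℕ}
    (h : ((s : ℤ) : E) * xi ^ a = ((t : ℤ) : E) * xi ^ b) : s = t ∧ a % 9 = b % 9 := by
  have h9 := congrArg (· ^ 9) h
  simp only [mul_pow, ← pow_mul, mul_comm _ 9] at h9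
  simp only [pow_mul, xi_pow_nine, one_pow, mul_one] at h9
  have hst : s = t := by
    have h1 : ∀ u : ℤˣ, ((u : ℤ) : E) ^ 9 = (u : ℤ) := by
      intro u
      rcases Int.units_eq_one_or u with rfl | rfl <;> norm_num
    rw [h1, h1] at h9
    exact Units.ext (by exact_mod_cast h9)
  subst hst
  have hs : ((s : ℤ) : E) ≠ 0 := by rcases Int.units_eq_one_or s with rfl | rfl <;> norm_num
  have hp := mul_left_cancel₀ hs h
  rw [xi_pow_mod a, xi_pow_mod b] at hp
  exact ⟨rfl, xi_spec.pow_inj (Nat.mod_lt _ (by norm_num)) (Nat.mod_lt _ (by norm_num)) hp⟩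

/-- If two images agree, the representatives differ by a monomial matrix on the right, so the first
column of one is a multiple of column `r` of the other. The first row shows that the factor is 1,
and the other rows determine signs and exponents. -/
theorem gam_smul_injective : Function.Injective fun i : Idx => gam i • v0 := by
  rintro i j hij
  have hfix : (gam i)⁻¹ * gam j ∈ MulAction.stabilizer Gam v0 := by
    rw [MulAction.mem_stabilizer_iff, mul_smul, ← show gam i • v0 = gam j • v0 from hij,
      inv_smul_smul]
  set h := (gam i)⁻¹ * gam j with hh
  have hmul : gam j = gam i * h := by rw [hh, mul_inv_cancel_left]
  obtain ⟨r, hr⟩ := exists_col_of_smul_v0_eq h.2 (MulAction.mem_stabilizer_iff.1 hfix) 0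
  have hcol : ∀ p, (gam j).1.1 p 0 = (gam i).1.1 p r * h.1.1 r 0 := by
    intro p
    rw [hmul]
    change ((gam i).1.1 * h.1.1) p 0 = _
    rw [Matrix.mul_apply]
    exact Finset.sum_eq_single r (fun b _ hb => by rw [hr b hb, mul_zero]) (by simp)
  simp only [gam_apply, hMatrix_eq] at hcol
  have hc : 1 / (xi ^ 3 - xi ^ 6) ≠ 0 := one_div_ne_zero sqrt_ne_zero
  have h0 : h.1.1 r 0 = 1 := by
    have := hcol 0
    simp at this
    exact (mul_eq_left₀ (by simpa using hc)).1 this.symm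
  have hp : ∀ p, (((![1, j.1, j.2.1] p : ℤˣ) : ℤ) : E) * xi ^ (![0, (j.2.2.1 : ℕ), j.2.2.2] p) =
      (((![1, i.1, i.2.1] p : ℤˣ) : ℤ) : E) * xi ^ (![0, (i.2.2.1 : ℕ), i.2.2.2] p + 3 * (p : ℕ) * r) := by
    intro p
    have := hcol p
    rw [h0] at this
    apply mul_right_cancel₀ hc
    rw [pow_add]
    simp only [Fin.val_zero, mul_zero, pow_zero, mul_one] at this
    rw [this]
    ring
  obtain ⟨s1, e1⟩ := sign_mul_xi_pow_inj (hp 1)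
  obtain ⟨s2, e2⟩ := sign_mul_xi_pow_inj (hp 2)
  obtain ⟨s, t, a, b⟩ := i
  obtain ⟨s', t', a', b'⟩ := j
  change s' = s at s1
  change t' = t at s2
  change (a' : ℕ) % 9 = ((a : ℕ) + 3 * 1 * (r : ℕ)) % 9 at e1
  change (b' : ℕ) % 9 = ((b : ℕ) + 3 * 2 * (r : ℕ)) % 9 at e2
  -- Passing to column `r` shifts the exponent in the middle row by `3r`; since `a` and `a'` are
  -- both below 3, this forces `r = 0`. That is why `a` ranges over three values only.
  have ha : a = a' := Fin.ext (by omega)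
  have hb : b = b' := Fin.ext (by omega)
  rw [s1, s2, ha, hb]

/-- The distance is at most 6 because `π³` clears the denominator `√-3`. It is even, and it exceeds
4 by rigidity, because a matrix with no zero entry is not monomial and so moves `v0`. -/
theorem gam_mem_sphere (i : Idx) : gam i • v0 ∈ sphere 6 v0 := by
  have hne : gam i • v0 ≠ v0 := by
    intro h
    obtain ⟨r, hr⟩ := exists_col_of_smul_v0_eq (gam i).2 h 0
    obtain ⟨p, hp⟩ : ∃ p : Fin 3, p ≠ r := exists_ne r
    have := hr p hp
    rw [gam_apply, hMatrix_eq] at this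
    refine absurd this (mul_ne_zero (mul_ne_zero ?_ (pow_ne_zero _ xi_ne_zero))
      (mul_ne_zero (one_div_ne_zero sqrt_ne_zero) (pow_ne_zero _ xi_ne_zero)))
    rcases Int.units_eq_one_or (![1, i.1, i.2.1] p) with h | h <;> rw [h] <;> norm_num
  have hreach := reachable_smul_v0 (gam i).1
  have hxi : xi ∈ Algebra.adjoin ℤ {xi} := Algebra.subset_adjoin rfl
  have hcoef : (1 - xi) ^ 3 * (1 / (xi ^ 3 - xi ^ 6)) =
      xi ^ 6 * (1 + (1 - xi ^ 6) * (xi ^ 2 - xi)) := by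
    rw [mul_one_div, div_eq_iff sqrt_ne_zero]
    linear_combination (-xi ^ 14 + xi ^ 13 + 2 * xi ^ 11 - 2 * xi ^ 10 + xi ^ 6 - 3 * xi ^ 5 +
      3 * xi ^ 4 - 2 * xi ^ 3 + 3 * xi ^ 2 - 3 * xi + 1) * xi_sum
  have hle : tree.dist v0 (gam i • v0) ≤ 2 * 3 := by
    refine (exists_walk_smul_v0 (gam i).1 fun p q => ?_).2
    have hmem : (1 - xi) ^ 3 * (gam i).1.1 p q ∈ Algebra.adjoin ℤ {xi} := by
      have e : (1 - xi) ^ 3 * (gam i).1.1 p q =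
          (((![1, i.1, i.2.1] p : ℤˣ) : ℤ) : E) * xi ^ (![0, (i.2.2.1 : ℕ), i.2.2.2] p) *
          ((1 - xi) ^ 3 * (1 / (xi ^ 3 - xi ^ 6))) * xi ^ (3 * (p : ℕ) * q) := by
        rw [gam_apply, hMatrix_eq]
        ring
      rw [e, hcoef]
      exact mul_mem (mul_mem (mul_mem (intCast_mem _ _) (pow_mem hxi _))
        (mul_mem (pow_mem hxi _) (add_mem (one_mem _) (mul_mem (sub_mem (one_mem _) (pow_mem hxi _))
          (sub_mem (pow_mem hxi _) hxi))))) (pow_mem hxi _)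
    obtain ⟨y, hy⟩ := adjoin_xi_integral hmem
    rw [← hy]
    exact algebraMap_int_mem y
  refine ⟨hreach, ?_⟩
  obtain ⟨k, hk, -⟩ := exists_dist_eq (gam i).1 hreach
  have h4 : ¬ tree.dist v0 (gam i • v0) ≤ 4 := fun h => hne (smul_v0_eq_of_dist_le (gam i).2 h)
  change tree.dist v0 (gam i • v0) = 2 * k at hk
  omega

/-! ## Clans -/

/-- The two points are at distance at most `2 + 2` through `p`; moving one of them to `v0` makes
rigidity applicable. -/
theorem eq_of_mem_clan {p u w : Vertex} (hu : u ∈ clan v0 p) (hw : w ∈ clan v0 p)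
    (hu' : u ∈ MulAction.orbit Gam v0) (hw' : w ∈ MulAction.orbit Gam v0) : u = w := by
  obtain ⟨g, rfl⟩ := hu'
  obtain ⟨h, rfl⟩ := hw'
  change g • v0 ∈ _ at hu
  change h • v0 ∈ _ at hw
  change g • v0 = h • v0
  have h1 := hu.2.1.symm.dist_triangle_left (h • v0)
  rw [SimpleGraph.dist_comm (u := g • v0) (v := p), hu.2.2, hw.2.2] at h1
  have h2 := dist_smul_le (g⁻¹ : Gam).1 (hu.2.1.symm.trans hw.2.1)
  have e1 : (g⁻¹ : Gam).1 • g • v0 = v0 := inv_smul_smul g v0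
  have e2 : (g⁻¹ : Gam).1 • h • v0 = (g⁻¹ * h : Gam).1 • v0 := (mul_smul g⁻¹ h v0).symm
  rw [e1, e2] at h2
  have h3 := smul_v0_eq_of_dist_le (g⁻¹ * h : Gam).2 (h2.trans h1)
  change (g⁻¹ * h) • v0 = v0 at h3
  rw [mul_smul, inv_smul_eq_iff] at h3
  exact h3.symm

/-- The 108 points `gam i • v0` occupy 108 different clans, and `sphere 4 v0` allows no more; an
injection into a finite set of at most that size is onto. -/
theorem clans_v0 : (clans v0).ncard = 108 ∧ ∀ c ∈ clans v0, ∃ i, gam i • v0 ∈ c := by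
  have hclans : clans v0 = clan v0 '' sphere 4 v0 := by
    ext c
    constructor
    · rintro ⟨p, hp, rfl⟩
      exact ⟨p, hp, rfl⟩
    · rintro ⟨p, hp, rfl⟩
      exact ⟨p, hp, rfl⟩
  have hS := sphere_finite 3 v0
  have hfin : (clans v0).Finite := hclans ▸ hS.1.image _
  have hle : (clans v0).ncard ≤ 108 := by
    rw [hclans]
    exact (Set.ncard_image_le hS.1).trans (by simpa using hS.2)
  have key : ∀ i, ∃ p ∈ sphere 4 v0, gam i • v0 ∈ clan v0 p := by
    intro i
    have hs := gam_mem_sphere i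
    obtain ⟨p, hp, h⟩ := exists_between hs.1 (m := 4) (by rw [hs.2]; norm_num)
    rw [hs.2] at h
    exact ⟨p, hp, hs, h⟩
  choose p hp hmem using key
  have hinj : Function.Injective fun i => clan v0 (p i) := by
    intro i j hij
    apply gam_smul_injective
    have h1 := hmem i
    rw [show clan v0 (p i) = clan v0 (p j) from hij] at h1
    exact eq_of_mem_clan h1 (hmem j) ⟨gam i, rfl⟩ ⟨gam j, rfl⟩
  have hcard : (Set.range fun i => clan v0 (p i)).ncard = 108 := by
    rw [← Set.image_univ, Set.ncard_image_of_injective _ hinj, Set.ncard_univ, Nat.card_eq_fintype_card]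
    rfl
  have hsub : (Set.range fun i => clan v0 (p i)) ⊆ clans v0 := by
    rintro _ ⟨i, rfl⟩
    exact ⟨p i, hp i, rfl⟩
  have heq := Set.eq_of_subset_of_ncard_le hsub (by rw [hcard]; exact hle) hfin
  refine ⟨heq ▸ hcard, fun c hc => ?_⟩
  rw [← heq] at hc
  obtain ⟨i, rfl⟩ := hc
  exact ⟨i, hmem i⟩

/-- Descent on the distance `d` to `v0`. Going through the fourth vertex of a geodesic, the clan
point `gam i • v0` is within `2 + (d - 4) = d - 2` of `g • v0`, so `(gam i)⁻¹ * g` has a smaller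
displacement. -/
theorem mem_orbit_Lam (n : ℕ) : ∀ g : Gam, tree.dist v0 (g • v0) ≤ n →
    g • v0 ∈ MulAction.orbit Lam v0 := by
  induction n using Nat.strong_induction_on with
  | _ n ih =>
    intro g hg
    by_cases h4 : tree.dist v0 (g • v0) ≤ 4
    · have : g • v0 = v0 := smul_v0_eq_of_dist_le g.2 h4
      rw [this]
      exact MulAction.mem_orbit_self _
    obtain ⟨p, hp, hpg⟩ := exists_between (reachable_smul_v0 g.1) (m := 4) (by
      change 4 ≤ tree.dist v0 (g • v0)
      omega)
    change g • v0 ∈ sphere (tree.dist v0 (g • v0) - 4) p at hpg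
    obtain ⟨i, hi⟩ := clans_v0.2 _ ⟨p, hp, rfl⟩
    have h1 := hi.2.1.symm.dist_triangle_left (g • v0)
    rw [SimpleGraph.dist_comm (u := gam i • v0) (v := p), hi.2.2, hpg.2] at h1
    have h2 := dist_smul_le ((gam i)⁻¹ : Gam).1 (hi.2.1.symm.trans hpg.1)
    have e1 : ((gam i)⁻¹ : Gam).1 • gam i • v0 = v0 := inv_smul_smul (gam i) v0
    have e2 : ((gam i)⁻¹ : Gam).1 • g • v0 = ((gam i)⁻¹ * g : Gam) • v0 :=
      (mul_smul (gam i)⁻¹ g v0).symm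
    rw [e1, e2] at h2
    obtain ⟨l, hl⟩ := ih (n - 1) (by omega) ((gam i)⁻¹ * g) (by omega)
    refine ⟨⟨gam i, gam_mem_Lam i⟩ * l, ?_⟩
    change (gam i * (l : Gam)) • v0 = g • v0
    change (l : Gam) • v0 = _ at hl
    rw [mul_smul, hl, mul_smul, smul_inv_smul]

theorem orbit_Lam_v0 : MulAction.orbit Lam v0 = MulAction.orbit Gam v0 := by
  apply Set.Subset.antisymm
  · rintro _ ⟨l, rfl⟩
    exact ⟨l.1, rfl⟩
  · rintro _ ⟨g, rfl⟩
    exact mem_orbit_Lam _ g le_rfl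

theorem existsUnique_of_mem_clans (g : Gam) {c : Set Vertex} (hc : c ∈ clans (g • v0)) :
    ∃! u, u ∈ c ∧ u ∈ MulAction.orbit Gam v0 := by
  change c ∈ clans (g.1 • v0) at hc
  rw [clans_smul] at hc
  obtain ⟨_, hd, rfl⟩ := hc
  obtain ⟨i, hi⟩ := clans_v0.2 _ hd
  obtain ⟨p, hp, rfl⟩ := hd
  refine ⟨g • gam i • v0, ⟨⟨_, hi, rfl⟩, ⟨g * gam i, mul_smul g (gam i) v0⟩⟩, ?_⟩
  rintro _ ⟨⟨u, hu, rfl⟩, hu'⟩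
  have h1 : u ∈ MulAction.orbit Gam v0 := by
    obtain ⟨k, hk⟩ := hu'
    refine ⟨g⁻¹ * k, ?_⟩
    change (g⁻¹ * k) • v0 = u
    change k • v0 = g • u at hk
    rw [mul_smul, hk, inv_smul_smul]
  change g • u = g • gam i • v0
  rw [eq_of_mem_clan hu hi h1 ⟨gam i, rfl⟩]

end CliffordD

end

theorem mainTheorem6 :
    (∀ v ∈ MulAction.orbit CliffordD.Gam CliffordD.v0,
      (CliffordD.clans v).ncard = 108 ∧
      ∀ c ∈ CliffordD.clans v, ∃! u, u ∈ c ∧ u ∈ MulAction.orbit CliffordD.Gam v) ∧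
    (∀ v ∈ MulAction.orbit CliffordD.Gam CliffordD.v0,
      ∀ c ∈ CliffordD.clans v, ∃! u, u ∈ c ∧ u ∈ MulAction.orbit CliffordD.Lam v) ∧
    MulAction.orbit CliffordD.Lam CliffordD.v0 =
      MulAction.orbit CliffordD.Gam CliffordD.v0 := by
  refine ⟨?_, ?_, CliffordD.orbit_Lam_v0⟩
  · rintro v hv
    rw [MulAction.orbit_eq_iff.2 hv]
    obtain ⟨g, rfl⟩ := hv
    refine ⟨?_, fun c hc => CliffordD.existsUnique_of_mem_clans g hc⟩
    change (CliffordD.clans (g.1 • CliffordD.v0)).ncard = 108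
    rw [CliffordD.clans_smul, Set.ncard_image_of_injective _
      (Set.image_injective.2 (MulAction.injective g.1))]
    exact CliffordD.clans_v0.1
  · rintro v hv c hc
    have hv' := hv
    rw [← CliffordD.orbit_Lam_v0] at hv'
    -- Since `v` already lies in the `Lam`-orbit of `v0`, its `Lam`-orbit is the full `Gam`-orbit of
    -- `v0`, and uniqueness for `Gam` applies.
    rw [MulAction.orbit_eq_iff.2 hv', CliffordD.orbit_Lam_v0]
    obtain ⟨g, rfl⟩ := hv
    exact CliffordD.existsUnique_of_mem_clans g hc
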